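/- An oriented knot diagram $D$ (on the sphere) is regarded up to orientation-preserving homeomorphism of the sphere; knots are identified with classes of diagrams under finite sequences of Reidemeister moves R1, R2, R3. Let $D$ have $n\ge 1$ arcs $x_1,\dots,x_n$ (the diagram without crossings has one arc), numbered in the order in which they are met, let $\pi_D=\langle x_1,\dots,x_n\mid r_1,\dots,r_n\rangle$ be the Wirtinger presentation of the knot group, where $r_i=x_{i+1}u^{\mp1}x_i^{-1}u^{\pm1}$ at the crossing at which $x_i$ ends and $x_{i+1}$ begins (indices mod $n$), $u$ is the over-arc, and the upper (lower) signs are taken at a positive (negative) crossing (for the diagram without crossings $r_1=1$). Let $\alpha:\pi_D\to\langle t\rangle\cong\mathbb Z$, $x_i\mapsto t$, be the abelianization, let $\rho:\pi_D\to GL_m(\mathbb C)$ be a representation, and let $\Phi:\mathbb Z F_n\to M_m(\mathbb C[t^{\pm1}])$ be the ring homomorphism with $\Phi(w)=t^{\alpha(w)}\rho(w)$ for $w$ in the free group $F_n$ on $x_1,\dots,x_n$. For indices $i,j$ let $M_{i,j}$ be the matrix of the $m\times m$ blocks $\Phi(\partial r_a/\partial x_b)$ (Fox derivatives), with block row $i$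 and block column $j$ removed (so the relator $r_i$ is omitted), and put $$\Delta_{D,\rho}(t)=\frac{\det M_{i,j}}{\det\bigl(1-\Phi(x_j)\bigr)}\in\mathbb C(t).$$ Write $f\doteq g$ if $f=ug$ for a unit $u$ of $\mathbb C[t^{\pm1}]$. Then: 1. If $D'$ arises from $D$ by a Reidemeister move (or by renaming crossings or moving the base point from which the arcs are numbered), there is exactly one isomorphism $\varphi:\pi_D\to\pi_{D'}$ that matches the meridians of the edges that agree outside the disc of the move. 2. Up to $\doteq$, $\Delta_{D,\rho}$ does not depend on $i$ and $j$. 3. (Invariance under Reidemeister moves.) In the situation of 1, $\Delta_{D,\rho'\circ\varphi}\doteq\Delta_{D',\rho'}$ for every $m$ and every $\rho':\pi_{D'}\to GL_m(\mathbb C)$, for all choices of indices on both sides. 4. (Knot invariant.) If $D$ and $D'$ are joined by a finite sequence of Reidemeister moves and their inverses, then there is an isomorphism $\varphi:\pi_D\to\pi_{D'}$ that is a composite of the isomorphisms of 1 and their inverses along such a sequence; and for every such $\varphi$, every $m$ and every $\rho':\pi_{D'}\to GL_m(\mathbb C)$ one has $\Delta_{D,\rho'\circ\varphi}\doteq\Delta_{D',\rho'}$,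 for all choices of indices on both sides. 5. If $\rho$ and $\rho'$ are conjugate representations of $\pi_D$, then $\Delta_{D,\rho}=\Delta_{D,\rho'}$ (for the same $i,j$). 6. If $\rho$ is conjugate to $\rho_1\oplus\rho_2$, then $\Delta_{D,\rho}=\Delta_{D,\rho_1}\,\Delta_{D,\rho_2}$ (for the same $i,j$). -/

import Mathlib

open scoped LaurentPolynomial

noncomputable section

/-! ## Oriented knot diagrams

An oriented knot diagram is recorded by its signed Gauss code: the cyclic word of the passages met
while travelling once along the knot. The code fixes the diagram on the oriented sphere. -/

/-- A passage through a crossing: the label of the crossing, whether we pass on the over-strand,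
and whether the crossing is positive. -/
structure Passage where
  crossing : ℕ
  isOver : Bool
  positive : Bool
  deriving DecidableEq

namespace Passage

/-- The other passage through the same crossing. -/
def partner (p : Passage) : Passage := ⟨p.crossing, !p.isOver, p.positive⟩

/-- Rename the crossings. -/
def relabel (f : Equiv.Perm ℕ) (p : Passage) : Passage := ⟨f p.crossing, p.isOver, p.positive⟩

end Passage

/-- A half-edge at a crossing: `(p, true)` is the half-edge by which the passage `p` leaves the
crossing, `(p, false)` the one by which it enters. -/
abbrev HalfEdge := Passage × Bool

namespace GaussCode

/-- The other half of the same edge. (`formPerm` sends each entry to the cyclically next one.) -/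
def flip (l : List Passage) : HalfEdge → HalfEdge
  | (p, true) => (l.formPerm p, false)
  | (p, false) => (l.formPerm.symm p, true)

/-- The next half-edge counterclockwise around a crossing. At a positive crossing the cyclic order
is over-out, under-out, over-in, under-in; at a negative crossing it is
over-out, under-in, over-in, under-out. -/
def rotate : HalfEdge → HalfEdge
  | (p, out) => (p.partner, if p.isOver = p.positive then out else !out)

/-- The number of faces: the half-edges of the code up to the relation generated by `d ∼ d'` where
`d'` follows `d` along the boundary of a face. -/
def faceCount (l : List Passage) : ℕ :=
  Nat.card (Quot fun d d' : {d : HalfEdge // d.1 ∈ l} => d'.1 = rotate (flip l d.1))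

/-- The under-passages in the order in which they are met. There is one for each crossing. -/
def unders (l : List Passage) : List Passage := l.filter fun p => !p.isOver

end GaussCode

/-- An oriented knot diagram on the sphere, with a base point on an edge: every crossing that occurs
is passed exactly once over and once under, and the Euler characteristic `V - E + F` is `2`
(a nonempty code has `E = 2 * V`). The empty code is the diagram without crossings. -/
structure KnotDiagram where
  code : List Passage
  nodup : (code.map fun p => (p.crossing, p.isOver)).Nodup
  paired : ∀ p ∈ code, p.partner ∈ code
  planar : code = [] ∨ GaussCode.faceCount code = (GaussCode.unders code).length + 2

/-! ## Reidemeister moves -/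

/-- In a third Reidemeister move let `c`, `d`, `e` be the crossings of the top with the middle
strand, of the top with the bottom strand, and of the middle with the bottom strand, and let
`sc`, `sd`, `se` say whether they are positive. The three strands bound a triangle exactly if the
passages of the top, middle and bottom strand come in the following orders, or all three in the
opposite orders; the move exchanges these two possibilities. -/
def topStrand (c d : ℕ) (sc sd : Bool) : List Passage :=
  if sd then [⟨c, true, sc⟩, ⟨d, true, sd⟩] else [⟨d, true, sd⟩, ⟨c, true, sc⟩]

/-- See `topStrand`. -/
def middleStrand (c e : ℕ) (sc se : Bool) : List Passage :=
  if se then [⟨c, false, sc⟩, ⟨e, true, se⟩] else [⟨e, true, se⟩, ⟨c, false, sc⟩]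

/-- See `topStrand`. The product of the three signs is positive iff `sc = (sd = se)`. -/
def bottomStrand (d e : ℕ) (sc sd se : Bool) : List Passage :=
  if sc = (sd == se) then [⟨d, false, sd⟩, ⟨e, false, se⟩]
  else [⟨e, false, se⟩, ⟨d, false, sd⟩]

/-- `ReidemeisterMove l l' E`: the code `l'` arises from `l` by moving the base point, renaming the
crossings, or one Reidemeister move. Gap `k` of a code lies after its first `k` entries, and `E k k'`
says that the edges at gap `k` of `l` and at gap `k'` of `l'` agree outside the disc in which the
move takes place. -/
inductive ReidemeisterMove : List Passage → List Passage → (ℕ → ℕ → Prop) → Prop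
  | basePoint (A B : List Passage) :
      ReidemeisterMove (A ++ B) (B ++ A) fun k k' =>
        (k ≤ A.length ∧ k' = B.length + k) ∨ (k' ≤ B.length ∧ k = A.length + k')
  | rename (f : Equiv.Perm ℕ) (l : List Passage) :
      ReidemeisterMove l (l.map (Passage.relabel f)) fun k k' => k ≤ l.length ∧ k' = k
  | r1 (c : ℕ) (o s : Bool) (l : List Passage) :
      ReidemeisterMove l ([⟨c, o, s⟩, ⟨c, !o, s⟩] ++ l) fun k k' =>
        (k = 0 ∧ k' = 0) ∨ (k ≤ l.length ∧ k' = k + 2)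
  | r2Parallel (c d : ℕ) (o s : Bool) (A B : List Passage) :
      ReidemeisterMove (A ++ B)
        ([⟨c, o, s⟩, ⟨d, o, !s⟩] ++ A ++ [⟨c, !o, s⟩, ⟨d, !o, !s⟩] ++ B) fun k k' =>
        (k = 0 ∧ k' = 0) ∨ (k ≤ A.length ∧ k' = k + 2) ∨
          (A.length ≤ k ∧ k ≤ A.length + B.length ∧ k' = k + 4)
  | r2Antiparallel (c d : ℕ) (o s : Bool) (A B : List Passage) :
      ReidemeisterMove (A ++ B)
        ([⟨c, o, s⟩, ⟨d, o, !s⟩] ++ A ++ [⟨d, !o, !s⟩, ⟨c, !o, s⟩] ++ B) fun k k' =>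
        (k = 0 ∧ k' = 0) ∨ (k ≤ A.length ∧ k' = k + 2) ∨
          (A.length ≤ k ∧ k ≤ A.length + B.length ∧ k' = k + 4)
  | r3TopMiddleBottom (c d e : ℕ) (sc sd se : Bool) (A B C : List Passage) :
      ReidemeisterMove
        (topStrand c d sc sd ++ A ++ middleStrand c e sc se ++ B ++
          bottomStrand d e sc sd se ++ C)
        ((topStrand c d sc sd).reverse ++ A ++ (middleStrand c e sc se).reverse ++ B ++
          (bottomStrand d e sc sd se).reverse ++ C) fun k k' =>
        k' = k ∧ k ≤ A.length + B.length + C.length + 6 ∧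
          k ≠ 1 ∧ k ≠ A.length + 3 ∧ k ≠ A.length + B.length + 5
  | r3TopBottomMiddle (c d e : ℕ) (sc sd se : Bool) (A B C : List Passage) :
      ReidemeisterMove
        (topStrand c d sc sd ++ A ++ bottomStrand d e sc sd se ++ B ++
          middleStrand c e sc se ++ C)
        ((topStrand c d sc sd).reverse ++ A ++ (bottomStrand d e sc sd se).reverse ++ B ++
          (middleStrand c e sc se).reverse ++ C) fun k k' =>
        k' = k ∧ k ≤ A.length + B.length + C.length + 6 ∧
          k ≠ 1 ∧ k ≠ A.length + 3 ∧ k ≠ A.length + B.length + 5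

/-! ## Fox calculus -/

/-- The free derivative of a word with respect to the generator `x`. -/
def foxWord {X : Type} [DecidableEq X] (x : X) :
    List (X × Bool) → MonoidAlgebra ℤ (FreeGroup X)
  | [] => 0
  | (y, true) :: w =>
      (if y = x then 1 else 0) + MonoidAlgebra.of ℤ _ (FreeGroup.of y) * foxWord x w
  | (y, false) :: w =>
      MonoidAlgebra.of ℤ _ (FreeGroup.of y)⁻¹ * ((if y = x then -1 else 0) + foxWord x w)

theorem foxWord_append {X : Type} [DecidableEq X] (x : X) (v w : List (X × Bool)) :
    foxWord x (v ++ w) = foxWord x v + MonoidAlgebra.of ℤ _ (FreeGroup.mk v) * foxWord x w := by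
  induction v with
  | nil =>
    rw [← FreeGroup.one_eq_mk, map_one]
    simp [foxWord]
  | cons a v ih =>
    obtain ⟨y, b⟩ := a
    have key : FreeGroup.mk ((y, b) :: v) = FreeGroup.mk [(y, b)] * FreeGroup.mk v := by
      rw [FreeGroup.mul_mk]
      rfl
    cases b
    · have h1 : FreeGroup.mk [(y, false)] = (FreeGroup.of y)⁻¹ := by
        rw [FreeGroup.of, FreeGroup.inv_mk]
        rfl
      rw [key, h1, map_mul]
      simp only [List.cons_append, foxWord, ih]
      noncomm_ring
    · have h1 : FreeGroup.mk [(y, true)] = FreeGroup.of y := rfl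
      rw [key, h1, map_mul]
      simp only [List.cons_append, foxWord, ih]
      noncomm_ring

theorem foxWord_step {X : Type} [DecidableEq X] (x : X) (v w : List (X × Bool))
    (h : FreeGroup.Red.Step v w) : foxWord x v = foxWord x w := by
  obtain @⟨L₁, L₂, y, b⟩ := h
  have hc : ∀ g : FreeGroup X, MonoidAlgebra.of ℤ (FreeGroup X) g *
      MonoidAlgebra.of ℤ (FreeGroup X) g⁻¹ = 1 := fun g => by
    rw [← map_mul, mul_inv_cancel, map_one]
  have hc' : ∀ g : FreeGroup X, MonoidAlgebra.of ℤ (FreeGroup X) g⁻¹ *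
      MonoidAlgebra.of ℤ (FreeGroup X) g = 1 := fun g => by
    rw [← map_mul, inv_mul_cancel, map_one]
  rw [foxWord_append, foxWord_append]
  congr 2
  cases b
  · simp only [Bool.not_false, foxWord]
    rw [← add_assoc, mul_add, ← mul_assoc, hc', one_mul]
    split_ifs <;> simp
  · simp only [Bool.not_true, foxWord]
    rw [← mul_assoc, hc, one_mul, ← add_assoc]
    split_ifs <;> simp

/-- The free derivative `∂g/∂x` of an element of the free group. -/
def foxDeriv {X : Type} [DecidableEq X] (x : X) (g : FreeGroup X) :
    MonoidAlgebra ℤ (FreeGroup X) :=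
  Quot.lift (foxWord x) (foxWord_step x) g

theorem foxDeriv_mul {X : Type} [DecidableEq X] (x : X) (g h : FreeGroup X) :
    foxDeriv x (g * h) = foxDeriv x g + MonoidAlgebra.of ℤ _ g * foxDeriv x h := by
  induction g using Quot.ind
  induction h using Quot.ind
  exact foxWord_append x _ _

theorem foxDeriv_of {X : Type} [DecidableEq X] (x y : X) :
    foxDeriv x (FreeGroup.of y) = if y = x then 1 else 0 := by
  change foxWord x [(y, true)] = _
  simp [foxWord]

/-! ## The Wirtinger presentation -/

namespace KnotDiagram

/-- The arcs, in the order in which they are met; arc `i` ends, and arc `i + 1` begins, at the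
`i`-th under-passage (indices modulo the number of arcs). There are as many arcs as crossings,
except that the diagram without crossings has one arc. -/
abbrev Arc (D : KnotDiagram) : Type := Fin ((GaussCode.unders D.code).length - 1 + 1)

/-- The arc that contains gap `k` of the code, the point after the first `k` passages. -/
def arcAt (D : KnotDiagram) (k : ℕ) : D.Arc :=
  Fin.ofNat _ (GaussCode.unders (D.code.take k)).length

/-- The Wirtinger relator `x_{i+1} u^{∓1} x_i^{-1} u^{±1}` of the `i`-th under-passage, where `u` is
the over-arc, with the upper signs at a positive crossing. (The diagram without crossings gets
the trivial relator.) -/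
def relator (D : KnotDiagram) (i : D.Arc) : FreeGroup D.Arc :=
  match (GaussCode.unders D.code)[i.val]? with
  | none => 1
  | some p =>
    let u := FreeGroup.of (D.arcAt (D.code.idxOf p.partner))
    if p.positive then FreeGroup.of (i + 1) * u⁻¹ * (FreeGroup.of i)⁻¹ * u
    else FreeGroup.of (i + 1) * u * (FreeGroup.of i)⁻¹ * u⁻¹

/-- The knot group, given by the Wirtinger presentation. -/
abbrev group (D : KnotDiagram) : Type := PresentedGroup (Set.range D.relator)

/-- The meridian in the knot group of the arc at gap `k`. -/
def meridian (D : KnotDiagram) (k : ℕ) : D.group := PresentedGroup.of (D.arcAt k)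

/-- `φ` is the isomorphism of knot groups induced by the move: it matches the meridians of
the edges outside the disc of the move. -/
def MatchesMeridians (D D' : KnotDiagram) (E : ℕ → ℕ → Prop) (φ : D.group ≃* D'.group) : Prop :=
  ∀ k k', E k k' → φ (D.meridian k) = D'.meridian k'

/-- Two diagrams present equivalent knots: they are joined by finitely many Reidemeister moves
and inverses of such. -/
def Equivalent : KnotDiagram → KnotDiagram → Prop :=
  Relation.EqvGen fun D D' => ∃ E, ReidemeisterMove D.code D'.code E

/-- `IsotopyIso D D' φ`: the isomorphism `φ` of knot groups is the composite of the isomorphisms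
induced by a finite sequence of Reidemeister moves and inverse moves leading from `D` to `D'`. -/
inductive IsotopyIso : (D D' : KnotDiagram) → (D.group ≃* D'.group) → Prop
  | refl (D : KnotDiagram) : IsotopyIso D D (MulEquiv.refl D.group)
  | move (D D' : KnotDiagram) (E : ℕ → ℕ → Prop) (φ : D.group ≃* D'.group)
      (h : ReidemeisterMove D.code D'.code E) (hφ : MatchesMeridians D D' E φ) :
      IsotopyIso D D' φ
  | symm (D D' : KnotDiagram) (φ : D.group ≃* D'.group) (h : IsotopyIso D D' φ) :
      IsotopyIso D' D φ.symm
  | trans (D D' D'' : KnotDiagram) (φ : D.group ≃* D'.group) (ψ : D'.group ≃* D''.group)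
      (h : IsotopyIso D D' φ) (h' : IsotopyIso D' D'' ψ) : IsotopyIso D D'' (φ.trans ψ)

/-! ## The twisted Alexander polynomial -/

/-- The abelianization `α`, which sends every meridian to the generator `t`. -/
def abel (D : KnotDiagram) : D.group →* Multiplicative ℤ :=
  PresentedGroup.toGroup (f := fun _ => Multiplicative.ofAdd 1) (by
    rintro _ ⟨i, rfl⟩
    unfold relator
    split
    · simp
    · dsimp only
      split_ifs <;> simp)

/-- `g ↦ ρ(g) t^{α(g)}`. -/
def tensorAbel (D : KnotDiagram) {m : ℕ}
    (ρ : D.group →* Matrix.GeneralLinearGroup (Fin m) ℂ) :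
    D.group →* Matrix (Fin m) (Fin m) ℂ[T;T⁻¹] where
  toFun g := (LaurentPolynomial.T (Multiplicative.toAdd (D.abel g)) : ℂ[T;T⁻¹]) •
    (ρ g : Matrix (Fin m) (Fin m) ℂ).map (LaurentPolynomial.C : ℂ →+* ℂ[T;T⁻¹])
  map_one' := by
    simp
  map_mul' g h := by
    rw [map_mul D.abel, map_mul ρ, toAdd_mul, LaurentPolynomial.T_add, Units.val_mul, Matrix.map_mul,
      smul_mul_smul_comm]

/-- The ring homomorphism `Φ` from the integral group ring of the free group on the arcs. -/
def Phi (D : KnotDiagram) {m : ℕ} (ρ : D.group →* Matrix.GeneralLinearGroup (Fin m) ℂ) :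
    MonoidAlgebra ℤ (FreeGroup D.Arc) →+* Matrix (Fin m) (Fin m) ℂ[T;T⁻¹] :=
  (MonoidAlgebra.lift ℤ (Matrix (Fin m) (Fin m) ℂ[T;T⁻¹]) (FreeGroup D.Arc)
    ((D.tensorAbel ρ).comp (PresentedGroup.mk (Set.range D.relator)))).toRingHom

/-- The matrix of all `m × m` blocks `Φ(∂r_a/∂x_b)`, without block row `i` and block column `j`. -/
def alexanderMatrix (D : KnotDiagram) {m : ℕ}
    (ρ : D.group →* Matrix.GeneralLinearGroup (Fin m) ℂ) (i j : D.Arc) :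
    Matrix (Fin ((GaussCode.unders D.code).length - 1) × Fin m)
      (Fin ((GaussCode.unders D.code).length - 1) × Fin m) ℂ[T;T⁻¹] :=
  Matrix.of fun a b =>
    D.Phi ρ (foxDeriv (j.succAbove b.1) (D.relator (i.succAbove a.1))) a.2 b.2

/-- The twisted Alexander polynomial `det M_j / det (1 - Φ(x_j))`, computed with the relator `r_i`
omitted. It is a rational function of `t`. -/
def twistedAlexander (D : KnotDiagram) {m : ℕ}
    (ρ : D.group →* Matrix.GeneralLinearGroup (Fin m) ℂ) (i j : D.Arc) :
    FractionRing ℂ[T;T⁻¹] :=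
  algebraMap ℂ[T;T⁻¹] _ (D.alexanderMatrix ρ i j).det /
    algebraMap ℂ[T;T⁻¹] _ (1 - D.Phi ρ (MonoidAlgebra.of ℤ _ (FreeGroup.of j))).det

end KnotDiagram

/-- Equality up to a unit of `ℂ[t, t⁻¹]`. -/
def EqUpToUnit (f g : FractionRing ℂ[T;T⁻¹]) : Prop :=
  ∃ u : ℂ[T;T⁻¹]ˣ, f = algebraMap ℂ[T;T⁻¹] _ (u : ℂ[T;T⁻¹]) * g

/-- Conjugate (equivalent) representations. -/
def RepEquiv {G : Type} [Group G] {m : ℕ}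
    (ρ ρ' : G →* Matrix.GeneralLinearGroup (Fin m) ℂ) : Prop :=
  ∃ P : Matrix.GeneralLinearGroup (Fin m) ℂ, ∀ g, ρ' g = P⁻¹ * ρ g * P

/-- The direct sum of two representations, by block diagonal matrices. -/
def RepSum {G : Type} [Group G] {m₁ m₂ : ℕ}
    (ρ₁ : G →* Matrix.GeneralLinearGroup (Fin m₁) ℂ)
    (ρ₂ : G →* Matrix.GeneralLinearGroup (Fin m₂) ℂ) :
    G →* Matrix.GeneralLinearGroup (Fin (m₁ + m₂)) ℂ :=
  MonoidHom.toHomUnits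
    { toFun := fun g => Matrix.reindex finSumFinEquiv finSumFinEquiv
        (Matrix.fromBlocks (ρ₁ g : Matrix (Fin m₁) (Fin m₁) ℂ) 0 0
          (ρ₂ g : Matrix (Fin m₂) (Fin m₂) ℂ))
      map_one' := by
        simp
      map_mul' := fun g h => by
        simp only [Matrix.reindex_apply, Matrix.submatrix_mul_equiv, Matrix.fromBlocks_multiply]
        simp }

end

/-!
The invariance of the twisted Alexander polynomial rests on the fact that, up to units, it only
depends on the knot group, the representation and the class of the meridians.

*The polynomial and the group.* The matrix `M_{i,j}` is a square presentation matrix of a module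
over `ℂ[t, t⁻¹]`. By the fundamental formula of Fox calculus this module carries the universal
crossed homomorphism of the knot group (twisted by `Φ`) that vanishes on the meridian `x_j`, see
`KnotDiagram.exists_universal_crossed`. A universal object does not depend on the presentation, and
square presentation matrices of isomorphic modules have associated determinants
(`associated_det_of_cokernel_equiv`, the invariance of the zeroth Fitting ideal). So an isomorphism
of knot groups that sends `x_j` to `x_j'` preserves the numerator up to a unit, and it preserves
the denominator exactly. If `x_j` only goes to a conjugate of `x_j'`, an inner automorphism corrects
this at the cost of conjugating the representation, which changes nothing
(`KnotDiagram.IsMeridional.eqUpToUnit`). As all meridians of a knot are conjugate, the identity and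
the isomorphisms induced by Reidemeister moves are covered, which gives the independence of the
indices and the invariance at once.

*Planarity.* That the module is the right one although the relator `r_i` is omitted uses that the
diagram lies on the sphere: every relator is a consequence of the others. The faces can be labelled
by elements of the knot group so that the labels on both sides of an edge differ by its meridian
(`KnotDiagram.exists_faceLabel`), and with these labels as weights the relators telescope to zero
(`KnotDiagram.crossed_relator_eq_zero`). The labelling exists because the sphere is simply
connected, which has to be derived from `V - E + F = 2` (`exists_face_labelling`): the edges that
are bad for an optimal labelling would contain a cycle, this cycle would bound by a dimension count
(`exists_face_potential`), and its potential would show how to improve the labelling.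

*Reidemeister moves.* Homomorphisms from the knot group to a group `G` are colourings of the edges
of the Gauss code by elements of `G`, encoded by the colours of the over-strands and of the base
point (`GaussCode.IsColoring`). For each move, colourings can be transported in both directions,
and they are determined by the colours outside the disc (`ReidemeisterMove.colorings`). Applied to
the universal colourings by meridians this yields the unique isomorphism
(`KnotDiagram.existsUnique_matchesMeridians`).
-/

noncomputable section

/-! ### Determinants of square presentation matrices -/

section Fitting

variable {R : Type*} [CommRing R]

/-- If the rows of `N` lie in the row space of `N'`, then `det N'` divides `det N`. -/
theorem det_dvd_det_of_rows_mem_span {κ : Type*} [Fintype κ] [DecidableEq κ]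
    {N N' : Matrix κ κ R} (h : ∀ k, N.row k ∈ Submodule.span R (Set.range N'.row)) :
    N'.det ∣ N.det := by
  have h' : ∀ k, ∃ w : κ → R, ∑ a, w a • N'.row a = N.row k := fun k =>
    (Submodule.mem_span_range_iff_exists_fun R).1 (h k)
  choose W hW using h'
  have : N = Matrix.of W * N' := by
    ext k b
    have := congrFun (hW k) b
    simp only [Finset.sum_apply, Pi.smul_apply, smul_eq_mul, Matrix.row_apply] at this
    rw [← this, Matrix.mul_apply]
    rfl
  rw [this, Matrix.det_mul]
  exact Dvd.intro_left _ rfl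

/-- Half of the invariance of the zeroth Fitting ideal: the matrices `[M 0; -S 1]` and
`[1 -S'; 0 M']`, where `S` and `S'` express the two generating families by each other, have
determinants `det M` and `det M'`, and the rows of the second are relations of the joint family. -/
theorem det_dvd_det_of_presentations {Q ι ι' : Type*} [AddCommGroup Q] [Module R Q]
    [Fintype ι] [DecidableEq ι] [Fintype ι'] [DecidableEq ι']
    (M : Matrix ι ι R) (M' : Matrix ι' ι' R) (e : ι → Q) (e' : ι' → Q)
    (he : Submodule.span R (Set.range e) = ⊤) (he' : Submodule.span R (Set.range e') = ⊤)
    (hM : ∀ r : ι → R, ∑ k, r k • e k = 0 ↔ r ∈ Submodule.span R (Set.range M.row))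
    (hM' : ∀ r : ι' → R, ∑ k, r k • e' k = 0 ↔ r ∈ Submodule.span R (Set.range M'.row)) :
    M.det ∣ M'.det := by
  have hS : ∀ k, ∃ s : ι → R, ∑ a, s a • e a = e' k := fun k =>
    (Submodule.mem_span_range_iff_exists_fun R).1 (he ▸ Submodule.mem_top)
  have hS' : ∀ k, ∃ s : ι' → R, ∑ a, s a • e' a = e k := fun k =>
    (Submodule.mem_span_range_iff_exists_fun R).1 (he' ▸ Submodule.mem_top)
  choose S hS using hS
  choose S' hS' using hS'
  let N : Matrix (ι ⊕ ι') (ι ⊕ ι') R := Matrix.fromBlocks M 0 (-Matrix.of S) 1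
  let N' : Matrix (ι ⊕ ι') (ι ⊕ ι') R := Matrix.fromBlocks 1 (-Matrix.of S') 0 M'
  have hN : N.det = M.det := by simp [N]
  have hN' : N'.det = M'.det := by simp [N']
  rw [← hN, ← hN']
  apply det_dvd_det_of_rows_mem_span
  -- a relation of the joint family is a combination of the rows of `N`
  have key : ∀ r : ι ⊕ ι' → R, ∑ k, r (.inl k) • e k + ∑ k, r (.inr k) • e' k = 0 →
      r ∈ Submodule.span R (Set.range N.row) := by
    intro r hr
    have h1 : (fun k => r (.inl k) + ∑ a, r (.inr a) * S a k) ∈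
        Submodule.span R (Set.range M.row) := by
      rw [← hM, ← hr]
      simp_rw [add_smul, Finset.sum_add_distrib, Finset.sum_smul]
      rw [Finset.sum_comm]
      congr 1
      refine Finset.sum_congr rfl fun a _ => ?_
      rw [← hS a, Finset.smul_sum]
      simp [mul_smul]
    obtain ⟨w, hw⟩ := (Submodule.mem_span_range_iff_exists_fun R).1 h1
    rw [Submodule.mem_span_range_iff_exists_fun]
    refine ⟨Sum.elim w (fun a => r (.inr a)), ?_⟩
    ext (k | k)
    · have := congrFun hw k
      simp only [Finset.sum_apply, Pi.smul_apply, smul_eq_mul, Matrix.row_apply] at this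
      simp [N, Fintype.sum_sum_type, this]
    · simp [N, Fintype.sum_sum_type, Matrix.one_apply]
  rintro (k | k)
  · apply key
    simp [N', Matrix.one_apply, ite_smul, hS']
  · apply key
    have := (hM' (M'.row k)).2 (Submodule.subset_span ⟨k, rfl⟩)
    simpa [N'] using this

/-- Square presentation matrices of isomorphic modules have associated determinants. -/
theorem associated_det_of_cokernel_equiv [IsDomain R] {ι ι' : Type*}
    [Fintype ι] [DecidableEq ι] [Fintype ι'] [DecidableEq ι']
    (M : Matrix ι ι R) (M' : Matrix ι' ι' R)
    (f : ((ι → R) ⧸ Submodule.span R (Set.range M.row)) ≃ₗ[R]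
      ((ι' → R) ⧸ Submodule.span R (Set.range M'.row))) :
    Associated M.det M'.det := by
  let e : ι → ((ι → R) ⧸ Submodule.span R (Set.range M.row)) :=
    fun k => Submodule.Quotient.mk (Pi.single k 1)
  let e' : ι' → ((ι' → R) ⧸ Submodule.span R (Set.range M'.row)) :=
    fun k => Submodule.Quotient.mk (Pi.single k 1)
  have sum_e : ∀ r : ι → R, ∑ k, r k • e k = Submodule.Quotient.mk r := by
    intro r
    conv_rhs => rw [pi_eq_sum_univ' r, ← Submodule.mkQ_apply, map_sum]
    exact Finset.sum_congr rfl fun k _ => (map_smul (Submodule.mkQ _) (r k) _).symm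
  have sum_e' : ∀ r : ι' → R, ∑ k, r k • e' k = Submodule.Quotient.mk r := by
    intro r
    conv_rhs => rw [pi_eq_sum_univ' r, ← Submodule.mkQ_apply, map_sum]
    exact Finset.sum_congr rfl fun k _ => (map_smul (Submodule.mkQ _) (r k) _).symm
  have he : Submodule.span R (Set.range (f ∘ e)) = ⊤ := by
    rw [eq_top_iff]
    intro q _
    obtain ⟨r, hr⟩ := Submodule.Quotient.mk_surjective _ (f.symm q)
    rw [Submodule.mem_span_range_iff_exists_fun]
    refine ⟨r, ?_⟩
    simp only [Function.comp_apply, ← map_smul, ← map_sum, sum_e, hr, f.apply_symm_apply]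
  have he' : Submodule.span R (Set.range e') = ⊤ := by
    rw [eq_top_iff]
    intro q _
    obtain ⟨r, rfl⟩ := Submodule.Quotient.mk_surjective _ q
    exact (Submodule.mem_span_range_iff_exists_fun R).2 ⟨r, sum_e' r⟩
  have hM : ∀ r : ι → R, ∑ k, r k • (f ∘ e) k = 0 ↔ r ∈ Submodule.span R (Set.range M.row) := by
    intro r
    simp only [Function.comp_apply, ← map_smul, ← map_sum, sum_e]
    rw [f.map_eq_zero_iff, Submodule.Quotient.mk_eq_zero]
  have hM' : ∀ r : ι' → R, ∑ k, r k • e' k = 0 ↔ r ∈ Submodule.span R (Set.range M'.row) := by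
    intro r
    rw [sum_e', Submodule.Quotient.mk_eq_zero]
  exact associated_of_dvd_dvd
    (det_dvd_det_of_presentations M M' (f ∘ e) e' he he' hM hM')
    (det_dvd_det_of_presentations M' M e' (f ∘ e) he' he hM' hM)

end Fitting

/-! ### Cycles in a cellular sphere -/

section Homology

variable {P V F : Type*} [Fintype P] [Fintype V] [Fintype F]

/-- The first homology of a sphere vanishes. For a graph with edges `P` and vertices `V` and a dual
graph on the faces `F`, both connected, with `V - E + F = 2`, the coboundaries of face functions and
of vertex functions are orthogonal, so they span all edge functions for dimension reasons. Hence an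
edge function orthogonal to the vertex coboundaries, that is a cycle, is a face coboundary. -/
theorem exists_face_potential (tail head : P → V) (left right : P → F)
    (euler : Fintype.card V + Fintype.card F = Fintype.card P + 2)
    (hV : ∀ ψ : V → ℚ, (∀ e, ψ (head e) = ψ (tail e)) → ∀ v w, ψ v = ψ w)
    (hF : ∀ φ : F → ℚ, (∀ e, φ (left e) = φ (right e)) → ∀ v w, φ v = φ w)
    (orth : ∀ (φ : F → ℚ) (ψ : V → ℚ),
      ∑ e, (φ (left e) - φ (right e)) * (ψ (head e) - ψ (tail e)) = 0)
    (z : P → ℚ) (hz : ∀ ψ : V → ℚ, ∑ e, z e * (ψ (head e) - ψ (tail e)) = 0) :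
    ∃ φ : F → ℚ, ∀ e, z e = φ (left e) - φ (right e) := by
  classical
  let T : (F → ℚ) × (V → ℚ) →ₗ[ℚ] (P → ℚ) :=
    { toFun := fun x e => x.1 (left e) - x.1 (right e) + (x.2 (head e) - x.2 (tail e))
      map_add' := fun x y => by ext e; simp; ring
      map_smul' := fun c x => by ext e; simp; ring }
  have sq_zero : ∀ a : P → ℚ, ∑ e, a e * a e = 0 → ∀ e, a e = 0 := fun a ha e =>
    mul_self_eq_zero.1
      ((Finset.sum_eq_zero_iff_of_nonneg fun e _ => mul_self_nonneg (a e)).1 ha e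
        (Finset.mem_univ e))
  have hker : ∀ x, T x = 0 → (∀ v w, x.1 v = x.1 w) ∧ ∀ v w, x.2 v = x.2 w := by
    rintro ⟨φ, ψ⟩ hx
    have hx' : ∀ e, φ (left e) - φ (right e) + (ψ (head e) - ψ (tail e)) = 0 :=
      fun e => congrFun hx e
    have h1 : ∀ e, φ (left e) - φ (right e) = 0 := by
      apply sq_zero
      rw [← neg_eq_zero, ← orth φ ψ, ← Finset.sum_neg_distrib]
      refine Finset.sum_congr rfl fun e _ => ?_
      rw [eq_neg_of_add_eq_zero_right (hx' e)]
      ring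
    refine ⟨hF φ fun e => sub_eq_zero.1 (h1 e), hV ψ fun e => sub_eq_zero.1 ?_⟩
    have := hx' e
    rwa [h1, zero_add] at this
  -- the kernel consists of pairs of constants
  have hdim : Module.finrank ℚ (LinearMap.ker T) ≤ 2 := by
    have hinj : ∃ ev : (F → ℚ) × (V → ℚ) →ₗ[ℚ] ℚ × ℚ, ∀ x, T x = 0 → ev x = 0 → x = 0 := by
      by_cases hFn : Nonempty F
      · by_cases hVn : Nonempty V
        · obtain ⟨f⟩ := hFn
          obtain ⟨v⟩ := hVn
          refine ⟨((LinearMap.proj f).comp (LinearMap.fst ℚ _ _)).prod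
            ((LinearMap.proj v).comp (LinearMap.snd ℚ _ _)), fun x hx h0 => ?_⟩
          obtain ⟨h1, h2⟩ := hker x hx
          simp only [LinearMap.prod_apply, Function.prod_apply, LinearMap.comp_apply,
            LinearMap.fst_apply, LinearMap.snd_apply, LinearMap.proj_apply, Prod.mk_eq_zero] at h0
          refine Prod.ext (funext fun a => ?_) (funext fun a => ?_)
          · exact (h1 a f).trans h0.1
          · exact (h2 a v).trans h0.2
        · obtain ⟨f⟩ := hFn
          rw [not_nonempty_iff] at hVn
          refine ⟨((LinearMap.proj f).comp (LinearMap.fst ℚ _ _)).prod 0, fun x hx h0 => ?_⟩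
          simp only [LinearMap.prod_apply, Function.prod_apply, LinearMap.comp_apply,
            LinearMap.fst_apply, LinearMap.proj_apply, Prod.mk_eq_zero] at h0
          refine Prod.ext (funext fun a => ?_) (Subsingleton.elim _ _)
          exact ((hker x hx).1 a f).trans h0.1
      · rw [not_nonempty_iff] at hFn
        by_cases hVn : Nonempty V
        · obtain ⟨v⟩ := hVn
          refine ⟨(0 : _ →ₗ[ℚ] ℚ).prod ((LinearMap.proj v).comp (LinearMap.snd ℚ _ _)),
            fun x hx h0 => ?_⟩
          simp only [LinearMap.prod_apply, Function.prod_apply, LinearMap.comp_apply,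
            LinearMap.snd_apply, LinearMap.proj_apply, Prod.mk_eq_zero] at h0
          refine Prod.ext (Subsingleton.elim _ _) (funext fun a => ?_)
          exact ((hker x hx).2 a v).trans h0.2
        · rw [not_nonempty_iff] at hVn
          exact ⟨0, fun x _ _ => Subsingleton.elim _ _⟩
    obtain ⟨ev, hev⟩ := hinj
    have : Function.Injective (ev.comp (LinearMap.ker T).subtype) := by
      rw [← LinearMap.ker_eq_bot, LinearMap.ker_eq_bot']
      rintro ⟨x, hx⟩ h0
      exact Subtype.ext (hev x hx h0)
    simpa using LinearMap.finrank_le_finrank_of_injective this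
  have hsurj : LinearMap.range T = ⊤ := by
    apply Submodule.eq_top_of_finrank_eq
    have h1 := T.finrank_range_add_finrank_ker
    have h2 := (LinearMap.range T).finrank_le
    simp only [Module.finrank_prod, Module.finrank_fintype_fun_eq_card] at h1 h2 ⊢
    omega
  obtain ⟨⟨φ, ψ⟩, hx⟩ : z ∈ LinearMap.range T := hsurj ▸ Submodule.mem_top
  have hx' : ∀ e, φ (left e) - φ (right e) + (ψ (head e) - ψ (tail e)) = z e :=
    fun e => congrFun hx e
  have h2 : ∀ e, ψ (head e) - ψ (tail e) = 0 := by
    apply sq_zero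
    have := hz ψ
    simp_rw [← hx', add_mul, Finset.sum_add_distrib, orth, zero_add] at this
    exact this
  exact ⟨φ, fun e => by rw [← hx', h2, add_zero]⟩

/-- A nonempty set of edges that meets no vertex exactly once supports a nonzero cycle, because
it meets at most as many vertices as it has edges, and boundaries have total sum zero. -/
theorem exists_cycle_of_no_leaf [DecidableEq V] (tail head : P → V) (B : Finset P) (hB : B.Nonempty)
    (hdeg : ∀ v, (B.filter fun e => tail e = v).card + (B.filter fun e => head e = v).card ≠ 1) :
    ∃ z : P → ℚ, z ≠ 0 ∧ (∀ e ∉ B, z e = 0) ∧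
      ∀ ψ : V → ℚ, ∑ e, z e * (ψ (head e) - ψ (tail e)) = 0 := by
  classical
  -- the vertices met by the edges of `B`
  let U : Finset V := B.image tail ∪ B.image head
  have hU : U.card ≤ B.card := by
    have h1 : ∑ v ∈ U, (B.filter fun e => tail e = v).card = B.card :=
      (Finset.card_eq_sum_card_fiberwise fun e he =>
        Finset.mem_union_left _ (Finset.mem_image_of_mem _ he)).symm
    have h2 : ∑ v ∈ U, (B.filter fun e => head e = v).card = B.card :=
      (Finset.card_eq_sum_card_fiberwise fun e he =>
        Finset.mem_union_right _ (Finset.mem_image_of_mem _ he)).symm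
    have h3 : ∑ v ∈ U, 2 ≤ ∑ v ∈ U,
        ((B.filter fun e => tail e = v).card + (B.filter fun e => head e = v).card) := by
      refine Finset.sum_le_sum fun v hv => ?_
      have h0 : (B.filter fun e => tail e = v).card + (B.filter fun e => head e = v).card ≠ 0 := by
        intro h
        rw [Nat.add_eq_zero_iff, Finset.card_eq_zero, Finset.card_eq_zero,
          Finset.filter_eq_empty_iff, Finset.filter_eq_empty_iff] at h
        rcases Finset.mem_union.1 hv with hv | hv <;>
          obtain ⟨e, he, rfl⟩ := Finset.mem_image.1 hv
        · exact h.1 he rfl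
        · exact h.2 he rfl
      have := hdeg v
      omega
    rw [Finset.sum_add_distrib, h1, h2, Finset.sum_const, smul_eq_mul] at h3
    omega
  let bd : (B → ℚ) →ₗ[ℚ] (U → ℚ) :=
    { toFun := fun z v => ∑ e : B, z e * ((if head e = v then 1 else 0) -
        (if tail e = v then 1 else 0))
      map_add' := fun x y => by ext v; simp [add_mul, Finset.sum_add_distrib]
      map_smul' := fun c x => by ext v; simp [Finset.mul_sum, mul_assoc] }
  have hsum : ∀ (z : B → ℚ) (ψ : V → ℚ),
      ∑ e : B, z e * (ψ (head e) - ψ (tail e)) = ∑ v : U, bd z v * ψ v := by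
    intro z ψ
    simp only [bd, LinearMap.coe_mk, AddHom.coe_mk, Finset.sum_mul]
    rw [Finset.sum_comm]
    refine Finset.sum_congr rfl fun e _ => ?_
    have key : ∀ w : V, w ∈ U → ∑ v : U, (if w = v then 1 else 0) * ψ v = ψ w := by
      intro w hw
      rw [Finset.sum_eq_single (⟨w, hw⟩ : U)]
      · simp
      · intro b _ hb
        rw [if_neg, zero_mul]
        rintro rfl
        exact hb rfl
      · simp
    rw [← key (head e) (Finset.mem_union_right _ (Finset.mem_image_of_mem _ e.2)),
      ← key (tail e) (Finset.mem_union_left _ (Finset.mem_image_of_mem _ e.2)),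
      ← Finset.sum_sub_distrib, Finset.mul_sum]
    refine Finset.sum_congr rfl fun v _ => ?_
    ring
  -- boundaries have total sum zero, so `bd` is not onto, and not injective for dimension reasons
  have hninj : LinearMap.ker bd ≠ ⊥ := by
    intro hker
    have hsurj : Function.Surjective bd := by
      rw [← LinearMap.range_eq_top]
      apply Submodule.eq_top_of_finrank_eq
      have h1 := bd.finrank_range_add_finrank_ker
      have h2 := (LinearMap.range bd).finrank_le
      rw [hker, finrank_bot] at h1
      simp only [Module.finrank_fintype_fun_eq_card, Fintype.card_coe] at h1 h2 ⊢
      omega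
    obtain ⟨e, he⟩ := hB
    obtain ⟨z, hz⟩ := hsurj
      (Pi.single ⟨tail e, Finset.mem_union_left _ (Finset.mem_image_of_mem _ he)⟩ 1)
    have := hsum z 1
    simp [hz] at this
  obtain ⟨z, hz, hz0⟩ := Submodule.exists_mem_ne_zero_of_ne_bot hninj
  refine ⟨fun e => if h : e ∈ B then z ⟨e, h⟩ else 0, ?_, fun e he => dif_neg he, fun ψ => ?_⟩
  · intro h
    apply hz0
    ext e
    simpa using congrFun h e
  · have := hsum z ψ
    rw [LinearMap.mem_ker.1 hz] at this
    simp only [Pi.zero_apply, zero_mul, Finset.sum_const_zero] at this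
    refine Eq.trans ?_ this
    rw [← Finset.sum_subset (Finset.subset_univ B), ← Finset.sum_attach]
    · exact Finset.sum_congr rfl fun e _ => by simp
    · intro e _ he
      simp [he]

end Homology

/-! ### Gaps and arcs -/

namespace GaussCode

theorem unders_append (l₁ l₂ : List Passage) : unders (l₁ ++ l₂) = unders l₁ ++ unders l₂ :=
  List.filter_append ..

theorem take_succ_of_getElem? {l : List Passage} {k : ℕ} {p : Passage} (h : l[k]? = some p) :
    l.take (k + 1) = l.take k ++ [p] := by
  rw [List.take_add_one, h]
  rfl

theorem take_unders (l : List Passage) (k : ℕ) :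
    (unders l).take (unders (l.take k)).length = unders (l.take k) := by
  conv_lhs => rw [← List.take_append_drop k l, unders_append]
  simp

theorem length_unders_take_le (l : List Passage) (k : ℕ) :
    (unders (l.take k)).length ≤ (unders l).length := by
  conv_rhs => rw [← List.take_append_drop k l, unders_append]
  simp

theorem unders_getElem? {l : List Passage} {k : ℕ} {p : Passage} (h : l[k]? = some p)
    (hp : p.isOver = false) : (unders l)[(unders (l.take k)).length]? = some p := by
  have h1 : unders (l.take (k + 1)) = unders (l.take k) ++ [p] := by
    rw [take_succ_of_getElem? h, unders_append]
    simp [unders, hp]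
  have h2 := take_unders l (k + 1)
  rw [h1] at h2
  have h3 := congrArg (fun t : List Passage => t[(unders (l.take k)).length]?) h2
  simpa [List.getElem?_take] using h3

end GaussCode

namespace KnotDiagram

open GaussCode

variable (D : KnotDiagram)

theorem code_nodup : D.code.Nodup := D.nodup.of_map _

theorem eq_of_crossing_eq {p q : Passage} (hp : p ∈ D.code) (hq : q ∈ D.code)
    (hc : p.crossing = q.crossing) (ho : p.isOver = q.isOver) : p = q :=
  List.inj_on_of_nodup_map D.nodup hp hq (Prod.ext hc ho)

theorem idxOf_eq {k : ℕ} {p : Passage} (h : D.code[k]? = some p) : D.code.idxOf p = k := by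
  obtain ⟨hk, rfl⟩ := List.getElem?_eq_some_iff.1 h
  exact D.code_nodup.idxOf_getElem k hk

theorem getElem?_idxOf {p : Passage} (h : p ∈ D.code) : D.code[D.code.idxOf p]? = some p :=
  List.getElem?_idxOf h

theorem arcAt_succ_over {k : ℕ} {p : Passage} (h : D.code[k]? = some p) (hp : p.isOver = true) :
    D.arcAt (k + 1) = D.arcAt k := by
  have h1 : unders [p] = [] := by simp [unders, hp]
  unfold arcAt
  rw [take_succ_of_getElem? h, unders_append, h1, List.append_nil]

theorem arcAt_succ_under {k : ℕ} {p : Passage} (h : D.code[k]? = some p)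
    (hp : p.isOver = false) : D.arcAt (k + 1) = D.arcAt k + 1 := by
  have h1 : unders [p] = [p] := by simp [unders, hp]
  unfold arcAt
  rw [take_succ_of_getElem? h, unders_append, h1, List.length_append, List.length_singleton]
  apply Fin.ext
  simp [Fin.val_add]

theorem arcAt_val_under {k : ℕ} {p : Passage} (h : D.code[k]? = some p) (hp : p.isOver = false) :
    (D.arcAt k).val = (unders (D.code.take k)).length := by
  have h1 := (List.getElem?_eq_some_iff.1 (unders_getElem? h hp)).1
  exact Nat.mod_eq_of_lt (by omega)

theorem arcAt_length : D.arcAt D.code.length = D.arcAt 0 := by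
  unfold arcAt
  rw [List.take_length, List.take_zero]
  apply Fin.ext
  simp only [Fin.val_ofNat]
  rcases Nat.eq_zero_or_pos (unders D.code).length with h | h
  · rw [h]; rfl
  · rw [Nat.sub_add_cancel h, Nat.mod_self]; rfl

/-- The Wirtinger relator at an under-passage, expressed by the gaps next to it. -/
theorem relator_arcAt {k : ℕ} {p : Passage} (h : D.code[k]? = some p) (hp : p.isOver = false) :
    D.relator (D.arcAt k) =
      if p.positive then
        FreeGroup.of (D.arcAt (k + 1)) * (FreeGroup.of (D.arcAt (D.code.idxOf p.partner)))⁻¹ *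
          (FreeGroup.of (D.arcAt k))⁻¹ * FreeGroup.of (D.arcAt (D.code.idxOf p.partner))
      else
        FreeGroup.of (D.arcAt (k + 1)) * FreeGroup.of (D.arcAt (D.code.idxOf p.partner)) *
          (FreeGroup.of (D.arcAt k))⁻¹ * (FreeGroup.of (D.arcAt (D.code.idxOf p.partner)))⁻¹ := by
  have h1 : (unders D.code)[(D.arcAt k).val]? = some p := by
    rw [D.arcAt_val_under h hp]
    exact unders_getElem? h hp
  unfold relator
  simp only [h1, D.arcAt_succ_under h hp]

/-- Every arc ends at an under-passage, unless there are no crossings. -/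
theorem exists_gap_of_arc (i : D.Arc) (hne : D.code ≠ []) :
    ∃ k p, D.code[k]? = some p ∧ p.isOver = false ∧ D.arcAt k = i := by
  have hpos : 0 < (unders D.code).length := by
    obtain ⟨p, hp⟩ := List.exists_mem_of_ne_nil _ hne
    rw [List.length_pos_iff_exists_mem]
    rcases hb : p.isOver with _ | _
    · exact ⟨p, List.mem_filter.2 ⟨hp, by simp [hb]⟩⟩
    · exact ⟨p.partner, List.mem_filter.2 ⟨D.paired p hp, by simp [Passage.partner, hb]⟩⟩
  have hi : i.val < (unders D.code).length := by
    have := i.isLt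
    omega
  have hmem : (unders D.code)[i.val] ∈ unders D.code := List.getElem_mem hi
  obtain ⟨h1, h2⟩ := List.mem_filter.1 hmem
  rw [Bool.not_eq_true'] at h2
  refine ⟨_, _, D.getElem?_idxOf h1, h2, Fin.ext ?_⟩
  rw [D.arcAt_val_under (D.getElem?_idxOf h1) h2]
  have h3 := unders_getElem? (D.getElem?_idxOf h1) h2
  obtain ⟨h4, h5⟩ := List.getElem?_eq_some_iff.1 h3
  exact ((D.code_nodup.filter _).getElem_inj_iff).1 h5

theorem exists_gap_eq_arc (i : D.Arc) : ∃ k ≤ D.code.length, D.arcAt k = i := by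
  by_cases hne : D.code = []
  · refine ⟨0, Nat.zero_le _, ?_⟩
    have : Subsingleton D.Arc := by
      have h : (unders D.code).length - 1 + 1 = 1 := by simp [hne, unders]
      rw [Arc, h]
      infer_instance
    exact Subsingleton.elim _ _
  · obtain ⟨k, p, h, -, hi⟩ := D.exists_gap_of_arc i hne
    exact ⟨k, (List.getElem?_eq_some_iff.1 h).1.le, hi⟩

theorem meridian_length : D.meridian D.code.length = D.meridian 0 :=
  congrArg PresentedGroup.of D.arcAt_length

theorem mk_relator (i : D.Arc) : PresentedGroup.mk (Set.range D.relator) (D.relator i) = 1 :=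
  PresentedGroup.one_of_mem ⟨i, rfl⟩

theorem mk_of (i : D.Arc) : PresentedGroup.mk (Set.range D.relator) (FreeGroup.of i) =
    PresentedGroup.of i := rfl

theorem meridian_succ_over {k : ℕ} {p : Passage} (h : D.code[k]? = some p)
    (hp : p.isOver = true) : D.meridian (k + 1) = D.meridian k :=
  congrArg PresentedGroup.of (D.arcAt_succ_over h hp)

theorem meridian_succ_under {k : ℕ} {p : Passage} (h : D.code[k]? = some p)
    (hp : p.isOver = false) : D.meridian (k + 1) =
      if p.positive then (D.meridian (D.code.idxOf p.partner))⁻¹ * D.meridian k *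
          D.meridian (D.code.idxOf p.partner)
      else D.meridian (D.code.idxOf p.partner) * D.meridian k *
          (D.meridian (D.code.idxOf p.partner))⁻¹ := by
  have h1 := D.mk_relator (D.arcAt k)
  rw [D.relator_arcAt h hp] at h1
  unfold meridian
  split_ifs with hs
  · rw [if_pos hs] at h1
    simp only [map_mul, map_inv, mk_of] at h1
    rw [mul_assoc, mul_eq_one_iff_eq_inv] at h1
    rw [← mul_inv_eq_iff_eq_mul, h1]
    group
  · rw [if_neg hs] at h1
    simp only [map_mul, map_inv, mk_of] at h1
    rw [mul_assoc, mul_eq_one_iff_eq_inv] at h1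
    rw [← mul_inv_eq_iff_eq_mul, inv_inv, h1]
    group

theorem hom_ext_meridian {G : Type*} [Group G] {f g : D.group →* G}
    (h : ∀ k ≤ D.code.length, f (D.meridian k) = g (D.meridian k)) : f = g := by
  apply PresentedGroup.ext
  intro i
  obtain ⟨k, hk, rfl⟩ := D.exists_gap_eq_arc i
  exact h k hk

end KnotDiagram

/-! ### Colourings of Gauss codes -/

namespace GaussCode

variable {G : Type*} [Group G]

/-- The colour after the passage `p` when the colour before it is `x` and the over-strand at each
crossing `c` has colour `u c`. -/
def step (u : ℕ → G) (x : G) (p : Passage) : G :=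
  if p.isOver then x
  else if p.positive then (u p.crossing)⁻¹ * x * u p.crossing
  else u p.crossing * x * (u p.crossing)⁻¹

/-- The colour after the passages of `l`, starting from the colour `x`. -/
def walk (u : ℕ → G) (x : G) (l : List Passage) : G := l.foldl (step u) x

/-- The prescribed colours `u` of the over-strands are those met on the way. -/
def Agrees (u : ℕ → G) : G → List Passage → Prop
  | _, [] => True
  | x, p :: l => (p.isOver = true → u p.crossing = x) ∧ Agrees u (step u x p) l

/-- `u` and `x` define a colouring of the edges of a closed code which satisfies the Wirtinger
relations: `x` is the colour at the base point and `u c` the colour of the over-strand at `c`. -/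
def IsColoring (u : ℕ → G) (x : G) (l : List Passage) : Prop :=
  Agrees u x l ∧ walk u x l = x

@[simp] theorem walk_nil (u : ℕ → G) (x : G) : walk u x [] = x := rfl

@[simp] theorem walk_cons (u : ℕ → G) (x : G) (p : Passage) (l : List Passage) :
    walk u x (p :: l) = walk u (step u x p) l := rfl

@[simp] theorem walk_append (u : ℕ → G) (x : G) (l₁ l₂ : List Passage) :
    walk u x (l₁ ++ l₂) = walk u (walk u x l₁) l₂ := List.foldl_append

@[simp] theorem agrees_nil (u : ℕ → G) (x : G) : Agrees u x [] := trivial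

@[simp] theorem agrees_cons (u : ℕ → G) (x : G) (p : Passage) (l : List Passage) :
    Agrees u x (p :: l) ↔ (p.isOver = true → u p.crossing = x) ∧ Agrees u (step u x p) l :=
  Iff.rfl

@[simp] theorem agrees_append (u : ℕ → G) (x : G) (l₁ l₂ : List Passage) :
    Agrees u x (l₁ ++ l₂) ↔ Agrees u x l₁ ∧ Agrees u (walk u x l₁) l₂ := by
  induction l₁ generalizing x with
  | nil => simp
  | cons p l ih => simp [ih, and_assoc]

theorem step_congr {u v : ℕ → G} {p : Passage} (h : u p.crossing = v p.crossing) (x : G) :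
    step u x p = step v x p := by
  simp [step, h]

theorem walk_congr {u v : ℕ → G} {l : List Passage} (h : ∀ p ∈ l, u p.crossing = v p.crossing)
    (x : G) : walk u x l = walk v x l := by
  induction l generalizing x with
  | nil => rfl
  | cons p l ih =>
    rw [List.forall_mem_cons] at h
    rw [walk_cons, walk_cons, step_congr h.1, ih h.2]

theorem agrees_congr {u v : ℕ → G} {l : List Passage} (h : ∀ p ∈ l, u p.crossing = v p.crossing)
    (x : G) : Agrees u x l ↔ Agrees v x l := by
  induction l generalizing x with
  | nil => simp
  | cons p l ih =>
    rw [List.forall_mem_cons] at h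
    rw [agrees_cons, agrees_cons, step_congr h.1, ih h.2, h.1]

theorem walk_unders (u : ℕ → G) (x : G) (l : List Passage) : walk u x (unders l) = walk u x l := by
  induction l generalizing x with
  | nil => rfl
  | cons p l ih =>
    rcases hb : p.isOver with _ | _
    · have : unders (p :: l) = p :: unders l := by simp [unders, hb]
      rw [this, walk_cons, walk_cons, ih]
    · have h1 : unders (p :: l) = unders l := by simp [unders, hb]
      have h2 : step u x p = x := by simp [step, hb]
      rw [h1, walk_cons, h2, ih]

theorem walk_take_succ (u : ℕ → G) (x : G) {l : List Passage} {k : ℕ} {p : Passage}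
    (h : l[k]? = some p) : walk u x (l.take (k + 1)) = step u (walk u x (l.take k)) p := by
  rw [take_succ_of_getElem? h, walk_append]
  rfl

theorem Agrees.over {u : ℕ → G} {x : G} {l : List Passage} (hA : Agrees u x l) {k : ℕ}
    {p : Passage} (h : l[k]? = some p) (hp : p.isOver = true) :
    u p.crossing = walk u x (l.take k) := by
  obtain ⟨hk, rfl⟩ := List.getElem?_eq_some_iff.1 h
  rw [← List.take_append_drop k l, List.drop_eq_getElem_cons hk, agrees_append, agrees_cons] at hA
  exact hA.2.1 hp

theorem agrees_of_forall {u : ℕ → G} {x : G} {l : List Passage}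
    (h : ∀ k p, l[k]? = some p → p.isOver = true → u p.crossing = walk u x (l.take k)) :
    Agrees u x l := by
  induction l generalizing x with
  | nil => trivial
  | cons p l ih =>
    refine ⟨fun hp => h 0 p rfl hp, ih fun k q hk hq => ?_⟩
    exact h (k + 1) q hk hq

end GaussCode

namespace KnotDiagram

open GaussCode

variable (D : KnotDiagram) {G : Type*} [Group G]

/-- The colour of the over-strand at a crossing in the colouring given by a homomorphism. -/
def overColor (f : D.group →* G) (c : ℕ) : G :=
  f (D.meridian (D.code.findIdx fun q => q.isOver && q.crossing == c))

theorem overColor_eq (f : D.group →* G) {p : Passage} (hp : p ∈ D.code) (ho : p.isOver = true) :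
    D.overColor f p.crossing = f (D.meridian (D.code.idxOf p)) := by
  unfold overColor
  congr 2
  have h1 : D.code.findIdx (fun q => q.isOver && q.crossing == p.crossing) < D.code.length :=
    List.findIdx_lt_length_of_exists ⟨p, hp, by simp [ho]⟩
  have h2 := List.findIdx_getElem (w := h1)
  simp only [Bool.and_eq_true, beq_iff_eq] at h2
  have h3 := D.eq_of_crossing_eq (List.getElem_mem h1) hp h2.2 (h2.1.trans ho.symm)
  exact (D.idxOf_eq (List.getElem?_eq_some_iff.2 ⟨h1, h3⟩)).symm

theorem walk_overColor (f : D.group →* G) {k : ℕ} (hk : k ≤ D.code.length) :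
    walk (D.overColor f) (f (D.meridian 0)) (D.code.take k) = f (D.meridian k) := by
  induction k with
  | zero => rfl
  | succ k ih =>
    obtain ⟨p, hp⟩ : ∃ p, D.code[k]? = some p := ⟨_, List.getElem?_eq_getElem hk⟩
    rw [walk_take_succ _ _ hp, ih (Nat.le_of_succ_le hk)]
    rcases hb : p.isOver with _ | _
    · have h1 := D.overColor_eq f (D.paired p (List.mem_of_getElem? hp))
        (by simp [Passage.partner, hb])
      simp only [Passage.partner] at h1
      rw [D.meridian_succ_under hp hb]
      unfold step
      simp only [hb, h1, Passage.partner]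
      split_ifs <;> simp_all
    · rw [D.meridian_succ_over hp hb]
      simp [step, hb]

/-- A homomorphism from the knot group gives a colouring by the images of the meridians. -/
theorem isColoring_overColor (f : D.group →* G) :
    IsColoring (D.overColor f) (f (D.meridian 0)) D.code := by
  constructor
  · apply agrees_of_forall
    intro k p hk hp
    rw [D.overColor_eq f (List.mem_of_getElem? hk) hp, D.idxOf_eq hk, D.walk_overColor]
    exact (List.getElem?_eq_some_iff.1 hk).1.le
  · have := D.walk_overColor f le_rfl
    rwa [List.take_length, D.meridian_length] at this

variable {D} in
theorem walk_arcAt {u : ℕ → G} {x : G} (h : IsColoring u x D.code) (k : ℕ) :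
    walk u x ((unders D.code).take (D.arcAt k).val) = walk u x (D.code.take k) := by
  rw [← walk_unders u x (D.code.take k), ← take_unders]
  rcases (length_unders_take_le D.code k).lt_or_eq with h1 | h1
  · have : (D.arcAt k).val = (unders (D.code.take k)).length := Nat.mod_eq_of_lt (by omega)
    rw [this]
  · have h2 : (D.arcAt k).val = 0 := by
      change (unders (D.code.take k)).length % _ = 0
      rw [h1]
      rcases Nat.eq_zero_or_pos (unders D.code).length with h | h
      · rw [h]
      · rw [Nat.sub_add_cancel h, Nat.mod_self]
    rw [h1, h2, List.take_length, walk_unders, h.2]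
    rfl

variable {D} in
/-- The homomorphism from the knot group that corresponds to a colouring. -/
def ofColoring {u : ℕ → G} {x : G} (h : IsColoring u x D.code) : D.group →* G :=
  PresentedGroup.toGroup (f := fun i : D.Arc => walk u x ((unders D.code).take i.val)) (by
    rintro _ ⟨i, rfl⟩
    by_cases hne : D.code = []
    · have : D.relator i = 1 := by
        unfold relator
        simp [hne, unders]
      rw [this, map_one]
    obtain ⟨k, p, hk, hp, rfl⟩ := D.exists_gap_of_arc i hne
    have hpm := D.paired p (List.mem_of_getElem? hk)
    have h1 := h.1.over (D.getElem?_idxOf hpm) (by simp [Passage.partner, hp])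
    rw [D.relator_arcAt hk hp]
    split_ifs with hs
    · simp only [map_mul, map_inv, FreeGroup.lift_apply_of, walk_arcAt h, ← h1,
        walk_take_succ u x hk]
      simp [step, hp, hs, Passage.partner]
    · simp only [map_mul, map_inv, FreeGroup.lift_apply_of, walk_arcAt h, ← h1,
        walk_take_succ u x hk]
      simp [step, hp, hs, Passage.partner])

variable {D} in
theorem ofColoring_meridian {u : ℕ → G} {x : G} (h : IsColoring u x D.code) (k : ℕ) :
    ofColoring h (D.meridian k) = walk u x (D.code.take k) := by
  unfold ofColoring meridian
  rw [PresentedGroup.toGroup.of, walk_arcAt h]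

end KnotDiagram

/-! ### Transport of colourings along Reidemeister moves -/

namespace GaussCode

/-- Every colouring of `l` gives one of `l'` with the same colours at the gaps related by `E`. -/
def Transfers (l l' : List Passage) (E : ℕ → ℕ → Prop) : Prop :=
  ∀ (G : Type) [Group G] (u : ℕ → G) (x : G), IsColoring u x l →
    ∃ (u' : ℕ → G) (x' : G), IsColoring u' x' l' ∧
      ∀ k k', E k k' → walk u x (l.take k) = walk u' x' (l'.take k')

/-- A colouring of `l` is determined by its colours at the gaps in `S`. -/
def Determines (l : List Passage) (S : ℕ → Prop) : Prop :=
  ∀ (G : Type) [Group G] (u v : ℕ → G) (x y : G), IsColoring u x l → IsColoring v y l →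
    (∀ k, S k → walk u x (l.take k) = walk v y (l.take k)) →
    ∀ k ≤ l.length, walk u x (l.take k) = walk v y (l.take k)

theorem Determines.of_forall {l : List Passage} {S : ℕ → Prop} (h : ∀ k ≤ l.length, S k) :
    Determines l S := fun _ _ _ _ _ _ _ _ hS k hk => hS k (h k hk)

theorem take_length_add (A B : List Passage) (j : ℕ) :
    (A ++ B).take (A.length + j) = A ++ B.take j := List.take_length_add_append j

/-- Distinctness of the crossings of two disjoint parts of a code, the first of which contains both
passages through `c`. -/
theorem crossing_ne_of_nodup {L A : List Passage}
    (h : ((L ++ A).map fun p => (p.crossing, p.isOver)).Nodup) {c : ℕ}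
    (hc : ∀ o, (c, o) ∈ L.map fun p => (p.crossing, p.isOver)) :
    ∀ p ∈ A, p.crossing ≠ c := by
  rintro p hp rfl
  rw [List.map_append, List.nodup_append] at h
  exact h.2.2 _ (hc p.isOver) _ (List.mem_map_of_mem hp) rfl

/-! ### Moving the base point and renaming -/

theorem transfers_basePoint (A B : List Passage) :
    Transfers (A ++ B) (B ++ A) fun k k' =>
      (k ≤ A.length ∧ k' = B.length + k) ∨ (k' ≤ B.length ∧ k = A.length + k') := by
  intro G _ u x h
  have h1 := h.1
  have h2 := h.2
  rw [agrees_append] at h1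
  rw [walk_append] at h2
  refine ⟨u, walk u x A, ⟨?_, ?_⟩, ?_⟩
  · rw [agrees_append, h2]
    exact ⟨h1.2, h1.1⟩
  · rw [walk_append, h2]
  · rintro k k' (⟨hk, rfl⟩ | ⟨hk, rfl⟩)
    · rw [take_length_add, walk_append, h2, List.take_append_of_le_length hk]
    · rw [take_length_add, walk_append, List.take_append_of_le_length hk]

theorem walk_relabel {G : Type} [Group G] (f : Equiv.Perm ℕ) (u : ℕ → G) (x : G)
    (l : List Passage) :
    walk u x (l.map (Passage.relabel f)) = walk (u ∘ f) x l := by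
  induction l generalizing x with
  | nil => rfl
  | cons p l ih =>
    rw [List.map_cons, walk_cons, ih]
    rfl

theorem agrees_relabel {G : Type} [Group G] (f : Equiv.Perm ℕ) (u : ℕ → G) (x : G)
    (l : List Passage) :
    Agrees u x (l.map (Passage.relabel f)) ↔ Agrees (u ∘ f) x l := by
  induction l generalizing x with
  | nil => simp
  | cons p l ih =>
    rw [List.map_cons, agrees_cons, ih]
    rfl

theorem transfers_rename (f : Equiv.Perm ℕ) (l : List Passage) :
    Transfers l (l.map (Passage.relabel f)) fun k k' => k ≤ l.length ∧ k' = k := by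
  intro G _ u x h
  have hu : (u ∘ f.symm) ∘ f = u := by ext; simp
  refine ⟨u ∘ f.symm, x, ⟨?_, ?_⟩, ?_⟩
  · rw [agrees_relabel, hu]
    exact h.1
  · rw [walk_relabel, hu]
    exact h.2
  · rintro k k' ⟨-, rfl⟩
    rw [← List.map_take, walk_relabel, hu]

theorem transfers_rename_symm (f : Equiv.Perm ℕ) (l : List Passage) :
    Transfers (l.map (Passage.relabel f)) l fun k' k => k ≤ l.length ∧ k' = k := by
  intro G _ u x h
  refine ⟨u ∘ f, x, ⟨?_, ?_⟩, ?_⟩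
  · exact (agrees_relabel ..).1 h.1
  · exact (walk_relabel ..).symm.trans h.2
  · rintro k k' ⟨-, rfl⟩
    rw [← List.map_take, walk_relabel]

/-! ### The first move -/

section R1

variable (c : ℕ) (o s : Bool) (l : List Passage)

theorem transfers_r1 (h : ((([⟨c, o, s⟩, ⟨c, !o, s⟩] : List Passage) ++ l).map
      fun p : Passage => (p.crossing, p.isOver)).Nodup) :
    Transfers l (([⟨c, o, s⟩, ⟨c, !o, s⟩] : List Passage) ++ l) fun k k' =>
      (k = 0 ∧ k' = 0) ∨ (k ≤ l.length ∧ k' = k + 2) := by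
  intro G _ u x hu
  have hc := crossing_ne_of_nodup h (c := c) (by intro o'; cases o <;> cases o' <;> simp)
  have hcong : ∀ p ∈ l, Function.update u c x p.crossing = u p.crossing :=
    fun p hp => Function.update_of_ne (hc p hp) _ _
  have hw : walk (Function.update u c x) x [⟨c, o, s⟩, ⟨c, !o, s⟩] = x := by
    cases o <;> cases s <;> simp [step]
  refine ⟨Function.update u c x, x, ⟨?_, ?_⟩, ?_⟩
  · rw [agrees_append, hw, agrees_congr hcong]
    refine ⟨?_, hu.1⟩
    cases o <;> cases s <;> simp [step]
  · rw [walk_append, hw, walk_congr hcong, hu.2]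
  · rintro k k' (⟨rfl, rfl⟩ | ⟨hk, rfl⟩)
    · rfl
    · have : (([⟨c, o, s⟩, ⟨c, !o, s⟩] : List Passage) ++ l).take (k + 2) =
        ([⟨c, o, s⟩, ⟨c, !o, s⟩] : List Passage) ++ l.take k := rfl
      rw [this, walk_append, hw]
      exact (walk_congr (fun p hp => hcong p (List.mem_of_mem_take hp)) x).symm

variable {c o s} in
theorem overColor_r1 {G : Type} [Group G] {u : ℕ → G} {x : G}
    (h : Agrees u x [⟨c, o, s⟩, ⟨c, !o, s⟩]) : u c = x := by
  cases o
  · cases s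
    · simp only [agrees_cons, step, Bool.not_false, Bool.false_eq_true, if_false] at h
      exact (mul_left_cancel (eq_mul_inv_iff_mul_eq.1 (h.2.1 trivial)))
    · simp only [agrees_cons, step, Bool.not_false, Bool.false_eq_true, if_false, if_true] at h
      have h1 := h.2.1 trivial
      rw [mul_assoc, eq_inv_mul_iff_mul_eq] at h1
      exact mul_right_cancel h1
  · exact h.1 rfl

variable {c o s} in
theorem walk_r1 {G : Type} [Group G] {u : ℕ → G} {x : G}
    (h : Agrees u x [⟨c, o, s⟩, ⟨c, !o, s⟩]) : walk u x [⟨c, o, s⟩, ⟨c, !o, s⟩] = x := by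
  have := overColor_r1 h
  cases o <;> cases s <;> simp [step, this]

theorem transfers_r1_symm :
    Transfers (([⟨c, o, s⟩, ⟨c, !o, s⟩] : List Passage) ++ l) l fun k' k =>
      (k = 0 ∧ k' = 0) ∨ (k ≤ l.length ∧ k' = k + 2) := by
  intro G _ u x hu
  have h1 := hu.1
  have h2 := hu.2
  rw [agrees_append] at h1
  have hw := walk_r1 h1.1
  rw [hw] at h1
  rw [walk_append, hw] at h2
  refine ⟨u, x, ⟨h1.2, h2⟩, ?_⟩
  rintro k' k (⟨rfl, rfl⟩ | ⟨hk, rfl⟩)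
  · rfl
  · have : (([⟨c, o, s⟩, ⟨c, !o, s⟩] : List Passage) ++ l).take (k + 2) =
      ([⟨c, o, s⟩, ⟨c, !o, s⟩] : List Passage) ++ l.take k := rfl
    rw [this, walk_append, hw]

theorem determines_r1 : Determines (([⟨c, o, s⟩, ⟨c, !o, s⟩] : List Passage) ++ l) fun k' =>
    ∃ k, (k = 0 ∧ k' = 0) ∨ (k ≤ l.length ∧ k' = k + 2) := by
  intro G _ u v x y hu hv h k hk
  match k with
  | 0 => exact h 0 ⟨0, .inl ⟨rfl, rfl⟩⟩
  | 1 =>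
    have h0 : x = y := h 0 ⟨0, .inl ⟨rfl, rfl⟩⟩
    have h1 := hu.1
    have h2 := hv.1
    subst h0
    rw [agrees_append] at h1 h2
    have h3 := overColor_r1 h1.1
    have h4 := overColor_r1 h2.1
    simp [step, h3, h4]
  | k + 2 => exact h (k + 2) ⟨k, .inr ⟨by simpa using hk, rfl⟩⟩

end R1

/-! ### The second move -/

/-- What colourings need of the strands `X` and `Y` of a second Reidemeister move: they leave the
disc with the colours with which they enter it, and the colours on entry determine those between
the two crossings. -/
structure IsBigon (X Y : List Passage) : Prop where
  walk_left : ∀ (G : Type) [Group G] (u : ℕ → G) (x y : G), Agrees u x X → Agrees u y Y →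
    walk u x X = x
  walk_right : ∀ (G : Type) [Group G] (u : ℕ → G) (x y : G), Agrees u x X → Agrees u y Y →
    walk u y Y = y
  inner : ∀ (G : Type) [Group G] (u v : ℕ → G) (x y : G), Agrees u x X → Agrees u y Y →
    Agrees v x X → Agrees v y Y →
    walk u x (X.take 1) = walk v x (X.take 1) ∧ walk u y (Y.take 1) = walk v y (Y.take 1)
  length_left : X.length = 2
  length_right : Y.length = 2

section R2

variable {X Y : List Passage} (A B : List Passage)

theorem transfers_bigon (h : IsBigon X Y) (c d : ℕ)
    (hex : ∀ (G : Type) [Group G] (u : ℕ → G) (x y : G), ∃ u' : ℕ → G,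
      (∀ a, a ≠ c → a ≠ d → u' a = u a) ∧ Agrees u' x X ∧ Agrees u' y Y)
    (hcd : ∀ p ∈ A ++ B, p.crossing ≠ c ∧ p.crossing ≠ d) :
    Transfers (A ++ B) (X ++ A ++ Y ++ B) fun k k' =>
      (k = 0 ∧ k' = 0) ∨ (k ≤ A.length ∧ k' = k + 2) ∨
        (A.length ≤ k ∧ k ≤ A.length + B.length ∧ k' = k + 4) := by
  intro G _ u x hu
  obtain ⟨u', hu', hX, hY⟩ := hex G u x (walk u x A)
  have hA : ∀ p ∈ A, u' p.crossing = u p.crossing := fun p hp =>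
    have := hcd p (List.mem_append_left _ hp)
    hu' _ this.1 this.2
  have hB : ∀ p ∈ B, u' p.crossing = u p.crossing := fun p hp =>
    have := hcd p (List.mem_append_right _ hp)
    hu' _ this.1 this.2
  have wX := h.walk_left G u' x _ hX hY
  have wY := h.walk_right G u' x _ hX hY
  have h1 := hu.1
  have h2 := hu.2
  rw [agrees_append] at h1
  rw [walk_append] at h2
  refine ⟨u', x, ⟨?_, ?_⟩, ?_⟩
  · simp only [agrees_append, walk_append, wX, walk_congr hA, wY]
    exact ⟨⟨⟨hX, (agrees_congr hA x).2 h1.1⟩, hY⟩, (agrees_congr hB _).2 h1.2⟩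
  · simp only [walk_append, wX, walk_congr hA, wY, walk_congr hB, h2]
  · rintro k k' (⟨rfl, rfl⟩ | ⟨hk, rfl⟩ | ⟨hk, -, rfl⟩)
    · rfl
    · have e : k + 2 = X.length + k := by rw [h.length_left, add_comm]
      rw [List.take_append_of_le_length hk, List.append_assoc, List.append_assoc, e,
        take_length_add, List.take_append_of_le_length hk, walk_append, wX]
      exact (walk_congr (fun p hp => hA p (List.mem_of_mem_take hp)) x).symm
    · obtain ⟨j, rfl⟩ := Nat.exists_eq_add_of_le hk
      have e : A.length + j + 4 = (X ++ A ++ Y).length + j := by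
        simp only [List.length_append, h.length_left, h.length_right]
        omega
      rw [e, take_length_add, take_length_add]
      simp only [walk_append, wX, walk_congr hA, wY]
      exact (walk_congr (fun p hp => hB p (List.mem_of_mem_take hp)) _).symm

theorem transfers_bigon_symm (h : IsBigon X Y) :
    Transfers (X ++ A ++ Y ++ B) (A ++ B) fun k' k =>
      (k = 0 ∧ k' = 0) ∨ (k ≤ A.length ∧ k' = k + 2) ∨
        (A.length ≤ k ∧ k ≤ A.length + B.length ∧ k' = k + 4) := by
  intro G _ u x hu
  have h1 := hu.1
  have h2 := hu.2
  simp only [agrees_append, walk_append] at h1 h2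
  obtain ⟨⟨⟨hX, hA⟩, hY⟩, hB⟩ := h1
  have wX := h.walk_left G u x _ hX hY
  have wY := h.walk_right G u x _ hX hY
  rw [wX] at hA wY
  rw [wX, wY] at hB h2
  refine ⟨u, x, ⟨?_, ?_⟩, ?_⟩
  · rw [agrees_append]
    exact ⟨hA, hB⟩
  · rw [walk_append, h2]
  · rintro k' k (⟨rfl, rfl⟩ | ⟨hk, rfl⟩ | ⟨hk, -, rfl⟩)
    · rfl
    · have e : k + 2 = X.length + k := by rw [h.length_left, add_comm]
      rw [List.take_append_of_le_length hk, List.append_assoc, List.append_assoc, e,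
        take_length_add, List.take_append_of_le_length hk, walk_append, wX]
    · obtain ⟨j, rfl⟩ := Nat.exists_eq_add_of_le hk
      have e : A.length + j + 4 = (X ++ A ++ Y).length + j := by
        simp only [List.length_append, h.length_left, h.length_right]
        omega
      rw [e, take_length_add, take_length_add]
      simp only [walk_append, wX, wY]

theorem determines_bigon (h : IsBigon X Y) :
    Determines (X ++ A ++ Y ++ B) fun k' => ∃ k,
      (k = 0 ∧ k' = 0) ∨ (k ≤ A.length ∧ k' = k + 2) ∨
        (A.length ≤ k ∧ k ≤ A.length + B.length ∧ k' = k + 4) := by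
  intro G _ u v x y hu hv hk0 k hk
  have hxy : x = y := hk0 0 ⟨0, .inl ⟨rfl, rfl⟩⟩
  subst hxy
  have hA := hk0 (A.length + 2) ⟨A.length, .inr (.inl ⟨le_rfl, rfl⟩)⟩
  have e : A.length + 2 = (X ++ A).length + 0 := by
    simp only [List.length_append, h.length_left]
    omega
  have h1 := hu.1
  have h2 := hv.1
  rw [e, List.append_assoc, take_length_add, List.take_zero, List.append_nil] at hA
  simp only [agrees_append] at h1 h2
  have hin := h.inner G u v x (walk u x (X ++ A)) h1.1.1.1 h1.1.2 h2.1.1.1 (hA ▸ h2.1.2)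
  have hlen : k ≤ A.length + B.length + 4 := by
    simp only [List.length_append, h.length_left, h.length_right] at hk
    omega
  have hcases : k = 0 ∨ k = 1 ∨ (2 ≤ k ∧ k ≤ A.length + 2) ∨ k = A.length + 3 ∨
      A.length + 4 ≤ k := by omega
  rcases hcases with rfl | rfl | hk1 | rfl | hk1
  · rfl
  · rw [List.append_assoc, List.append_assoc,
      List.take_append_of_le_length (by rw [h.length_left]; omega)]
    exact hin.1
  · exact hk0 k ⟨k - 2, .inr (.inl ⟨by omega, by omega⟩)⟩
  · have e : A.length + 3 = (X ++ A).length + 1 := by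
      simp only [List.length_append, h.length_left]
      omega
    rw [e, List.append_assoc (X ++ A), take_length_add,
      List.take_append_of_le_length (by rw [h.length_right]; omega), walk_append,
      walk_append _ _ (X ++ A), ← hA]
    exact hin.2
  · exact hk0 k ⟨k - 4, .inr (.inr ⟨by omega, by omega, by omega⟩)⟩

variable {c d : ℕ} (o s : Bool)

theorem isBigon_parallel :
    IsBigon [⟨c, o, s⟩, ⟨d, o, !s⟩] [⟨c, !o, s⟩, ⟨d, !o, !s⟩] := by
  constructor
  · intro G _ u x y hX hY
    cases o <;> cases s <;> simp_all [step, mul_assoc]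
  · intro G _ u x y hX hY
    cases o <;> cases s <;> simp_all [step, mul_assoc]
  · intro G _ u v x y h1 h2 h3 h4
    cases o <;> cases s <;> simp_all [step, mul_assoc]
  · rfl
  · rfl

theorem isBigon_antiparallel :
    IsBigon [⟨c, o, s⟩, ⟨d, o, !s⟩] [⟨d, !o, !s⟩, ⟨c, !o, s⟩] := by
  constructor
  · intro G _ u x y hX hY
    cases o <;> cases s <;> simp_all [step, mul_assoc]
  · intro G _ u x y hX hY
    cases o <;> cases s <;> simp_all [step, mul_assoc]
  · intro G _ u v x y h1 h2 h3 h4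
    cases o <;> cases s <;> simp_all [step, mul_assoc]
  · rfl
  · rfl

theorem exists_agrees_bigon (hcd : c ≠ d) {Y : List Passage}
    (hY : Y = [⟨c, !o, s⟩, ⟨d, !o, !s⟩] ∨ Y = [⟨d, !o, !s⟩, ⟨c, !o, s⟩])
    (G : Type) [Group G] (u : ℕ → G) (x y : G) : ∃ u' : ℕ → G,
      (∀ a, a ≠ c → a ≠ d → u' a = u a) ∧ Agrees u' x [⟨c, o, s⟩, ⟨d, o, !s⟩] ∧
        Agrees u' y Y := by
  refine ⟨Function.update (Function.update u c (if o then x else y)) d (if o then x else y),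
    fun a hc hd => ?_, ?_, ?_⟩
  · rw [Function.update_of_ne hd, Function.update_of_ne hc]
  · cases o <;> simp [step, hcd]
  · rcases hY with rfl | rfl <;> cases o <;> simp [step, hcd]

end R2

end GaussCode

/-! ### The third move -/

namespace GaussCode

/-- The strands `T`, `M`, `N` may be replaced by `T'`, `M'`, `N'`: only the over-colour at the
crossing `e` has to be changed, and the colours at the ends of the strands are kept. -/
def TriangleMove (e : ℕ) (T M N T' M' N' : List Passage) : Prop :=
  ∀ (G : Type) [Group G] (u : ℕ → G) (x y z : G),
    Agrees u x T → Agrees u y M → Agrees u z N → ∃ w : G,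
      (Agrees (Function.update u e w) x T' ∧ Agrees (Function.update u e w) y M' ∧
        Agrees (Function.update u e w) z N') ∧
      walk (Function.update u e w) x T' = walk u x T ∧
      walk (Function.update u e w) y M' = walk u y M ∧
      walk (Function.update u e w) z N' = walk u z N

/-- The colours at both ends of the strands `T`, `M`, `N` determine those at their midpoints. -/
def TriangleDetermined (T M N : List Passage) : Prop :=
  ∀ (G : Type) [Group G] (u v : ℕ → G) (x y z : G),
    Agrees u x T → Agrees u y M → Agrees u z N → Agrees v x T → Agrees v y M → Agrees v z N →
    walk u x T = walk v x T → walk u y M = walk v y M → walk u z N = walk v z N →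
    walk u x (T.take 1) = walk v x (T.take 1) ∧ walk u y (M.take 1) = walk v y (M.take 1) ∧
      walk u z (N.take 1) = walk v z (N.take 1)

theorem TriangleMove.swap {e : ℕ} {T M N T' M' N' : List Passage}
    (h : TriangleMove e T M N T' M' N') : TriangleMove e T N M T' N' M' := by
  intro G _ u x y z h1 h2 h3
  obtain ⟨w, ⟨a, b, c⟩, a', b', c'⟩ := h G u x z y h1 h3 h2
  exact ⟨w, ⟨a, c, b⟩, a', c', b'⟩

theorem TriangleDetermined.swap {T M N : List Passage} (h : TriangleDetermined T M N) :
    TriangleDetermined T N M := by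
  intro G _ u v x y z h1 h2 h3 h4 h5 h6 h7 h8 h9
  obtain ⟨a, b, c⟩ := h G u v x z y h1 h3 h2 h4 h6 h5 h7 h9 h8
  exact ⟨a, c, b⟩

section R3

variable {e : ℕ} {T M N T' M' N' : List Passage} (A B C : List Passage)

theorem transfers_triangle (h : TriangleMove e T M N T' M' N')
    (hT : T.length = 2) (hM : M.length = 2) (hN : N.length = 2)
    (hT' : T'.length = 2) (hM' : M'.length = 2) (hN' : N'.length = 2)
    (he : ∀ p ∈ A ++ B ++ C, p.crossing ≠ e) :
    Transfers (T ++ A ++ M ++ B ++ N ++ C) (T' ++ A ++ M' ++ B ++ N' ++ C) fun k k' =>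
      k' = k ∧ k ≤ A.length + B.length + C.length + 6 ∧
        k ≠ 1 ∧ k ≠ A.length + 3 ∧ k ≠ A.length + B.length + 5 := by
  intro G _ u x hu
  have h1 := hu.1
  have h2 := hu.2
  simp only [agrees_append, walk_append] at h1 h2
  obtain ⟨⟨⟨⟨⟨aT, aA⟩, aM⟩, aB⟩, aN⟩, aC⟩ := h1
  obtain ⟨w, ⟨aT', aM', aN'⟩, wT, wM, wN⟩ := h G u _ _ _ aT aM aN
  set u' := Function.update u e w
  have hcong : ∀ p ∈ A ++ B ++ C, u' p.crossing = u p.crossing :=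
    fun p hp => Function.update_of_ne (he p hp) _ _
  simp only [List.mem_append, or_imp, forall_and] at hcong
  obtain ⟨⟨cA, cB⟩, cC⟩ := hcong
  refine ⟨u', x, ⟨?_, ?_⟩, ?_⟩
  · simp only [agrees_append, walk_append, wT, wM, wN, walk_congr cA, walk_congr cB,
      agrees_congr cA, agrees_congr cB, agrees_congr cC]
    exact ⟨⟨⟨⟨⟨aT', aA⟩, aM'⟩, aB⟩, aN'⟩, aC⟩
  · simp only [walk_append, wT, wM, wN, walk_congr cA, walk_congr cB, walk_congr cC, h2]
  · rintro k k' ⟨rfl, hk, hk1, hk2, hk3⟩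
    have hcases : k' = 0 ∨ (2 ≤ k' ∧ k' ≤ A.length + 2) ∨
        (A.length + 4 ≤ k' ∧ k' ≤ A.length + B.length + 4) ∨
        A.length + B.length + 6 ≤ k' := by omega
    rcases hcases with rfl | ⟨ha, hb⟩ | ⟨ha, hb⟩ | ha
    · rfl
    · obtain ⟨j, rfl⟩ := Nat.exists_eq_add_of_le ha
      have e1 : 2 + j = T.length + j := by rw [hT]
      have e2 : 2 + j = T'.length + j := by rw [hT']
      have hj : j ≤ A.length := by omega
      rw [e1]
      simp only [List.append_assoc, take_length_add]
      rw [← e1, e2]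
      simp only [take_length_add, List.take_append_of_le_length hj, walk_append, wT]
      exact (walk_congr (fun p hp => cA p (List.mem_of_mem_take hp)) _).symm
    · obtain ⟨j, rfl⟩ := Nat.exists_eq_add_of_le ha
      have e1 : A.length + 4 + j = (T ++ A ++ M).length + j := by
        simp only [List.length_append, hT, hM]; omega
      have e2 : A.length + 4 + j = (T' ++ A ++ M').length + j := by
        simp only [List.length_append, hT', hM']; omega
      have hj : j ≤ B.length := by omega
      rw [e1, List.append_assoc (T ++ A ++ M ++ B), List.append_assoc (T ++ A ++ M),
        take_length_add, ← e1, e2, List.append_assoc (T' ++ A ++ M' ++ B),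
        List.append_assoc (T' ++ A ++ M'), take_length_add, List.take_append_of_le_length hj,
        List.take_append_of_le_length hj]
      simp only [walk_append, wT, walk_congr cA, wM]
      exact (walk_congr (fun p hp => cB p (List.mem_of_mem_take hp)) _).symm
    · obtain ⟨j, rfl⟩ := Nat.exists_eq_add_of_le ha
      have e1 : A.length + B.length + 6 + j = (T ++ A ++ M ++ B ++ N).length + j := by
        simp only [List.length_append, hT, hM, hN]; omega
      have e2 : A.length + B.length + 6 + j = (T' ++ A ++ M' ++ B ++ N').length + j := by
        simp only [List.length_append, hT', hM', hN']; omega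
      rw [e1, take_length_add, ← e1, e2, take_length_add]
      simp only [walk_append, wT, walk_congr cA, wM, walk_congr cB, wN]
      exact (walk_congr (fun p hp => cC p (List.mem_of_mem_take hp)) _).symm

theorem determines_triangle (h : TriangleDetermined T M N)
    (hT : T.length = 2) (hM : M.length = 2) (hN : N.length = 2) :
    Determines (T ++ A ++ M ++ B ++ N ++ C) fun k =>
      k ≤ A.length + B.length + C.length + 6 ∧
        k ≠ 1 ∧ k ≠ A.length + 3 ∧ k ≠ A.length + B.length + 5 := by
  intro G _ u v x y hu hv hk0 k hk
  have hxy : x = y := hk0 0 (by omega)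
  subst hxy
  have h1 := hu.1
  have h2 := hv.1
  simp only [agrees_append] at h1 h2
  -- the colours at the five other ends of the strands
  have g1 : walk u x T = walk v x T := by
    have := hk0 2 (by omega)
    have e1 : 2 = T.length + 0 := by rw [hT]
    rw [e1] at this
    simp only [List.append_assoc, take_length_add] at this
    simpa using this
  have g2 : walk u x (T ++ A) = walk v x (T ++ A) := by
    have := hk0 (A.length + 2) (by omega)
    have e1 : A.length + 2 = (T ++ A).length + 0 := by
      simp only [List.length_append, hT]; omega
    rw [e1, List.append_assoc, List.append_assoc, List.append_assoc, take_length_add] at this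
    simpa only [List.take_zero, List.append_nil] using this
  have g3 : walk u x (T ++ A ++ M) = walk v x (T ++ A ++ M) := by
    have := hk0 (A.length + 4) (by omega)
    have e1 : A.length + 4 = (T ++ A ++ M).length + 0 := by
      simp only [List.length_append, hT, hM]; omega
    rw [e1, List.append_assoc (T ++ A ++ M ++ B), List.append_assoc (T ++ A ++ M),
      take_length_add] at this
    simpa only [List.take_zero, List.append_nil] using this
  have g4 : walk u x (T ++ A ++ M ++ B) = walk v x (T ++ A ++ M ++ B) := by
    have := hk0 (A.length + B.length + 4) (by omega)
    have e1 : A.length + B.length + 4 = (T ++ A ++ M ++ B).length + 0 := by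
      simp only [List.length_append, hT, hM]; omega
    rw [e1, List.append_assoc (T ++ A ++ M ++ B), take_length_add] at this
    simpa only [List.take_zero, List.append_nil] using this
  have g5 : walk u x (T ++ A ++ M ++ B ++ N) = walk v x (T ++ A ++ M ++ B ++ N) := by
    have := hk0 (A.length + B.length + 6) (by omega)
    have e1 : A.length + B.length + 6 = (T ++ A ++ M ++ B ++ N).length + 0 := by
      simp only [List.length_append, hT, hM, hN]; omega
    rw [e1, take_length_add] at this
    simpa only [List.take_zero, List.append_nil] using this
  obtain ⟨⟨⟨⟨⟨aT, -⟩, aM⟩, -⟩, aN⟩, -⟩ := h1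
  obtain ⟨⟨⟨⟨⟨aT', -⟩, aM'⟩, -⟩, aN'⟩, -⟩ := h2
  rw [walk_append u, walk_append v, ← g2] at g3
  rw [walk_append u _ (T ++ A ++ M ++ B), walk_append v _ (T ++ A ++ M ++ B), ← g4] at g5
  obtain ⟨f1, f2, f3⟩ := h G u v _ _ _ aT aM aN aT' (g2 ▸ aM') (g4 ▸ aN') g1 g3 g5
  have hlen : k ≤ A.length + B.length + C.length + 6 := by
    simp only [List.length_append, hT, hM, hN] at hk
    omega
  by_cases hk1 : k = 1
  · subst hk1
    simp only [List.append_assoc]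
    rwa [List.take_append_of_le_length (by omega)]
  by_cases hk2 : k = A.length + 3
  · have e1 : A.length + 3 = (T ++ A).length + 1 := by
      simp only [List.length_append, hT]; omega
    rw [hk2, e1, List.append_assoc, List.append_assoc, List.append_assoc, take_length_add,
      List.take_append_of_le_length (by omega), walk_append u _ (T ++ A),
      walk_append v _ (T ++ A), ← g2]
    exact f2
  by_cases hk3 : k = A.length + B.length + 5
  · have e1 : A.length + B.length + 5 = (T ++ A ++ M ++ B).length + 1 := by
      simp only [List.length_append, hT, hM]; omega
    rw [hk3, e1, List.append_assoc (T ++ A ++ M ++ B), take_length_add,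
      List.take_append_of_le_length (by omega), walk_append u _ (T ++ A ++ M ++ B),
      walk_append v _ (T ++ A ++ M ++ B), ← g4]
    exact f3
  exact hk0 k ⟨hlen, hk1, hk2, hk3⟩

end R3

section Strands

variable {c d e : ℕ} (sc sd se : Bool)

theorem length_topStrand : (topStrand c d sc sd).length = 2 := by
  cases sd <;> rfl

theorem length_middleStrand : (middleStrand c e sc se).length = 2 := by
  cases se <;> rfl

theorem length_bottomStrand : (bottomStrand d e sc sd se).length = 2 := by
  unfold bottomStrand
  split_ifs <;> rfl

theorem triangleMove (hce : c ≠ e) (hde : d ≠ e) :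
    TriangleMove e (topStrand c d sc sd) (middleStrand c e sc se) (bottomStrand d e sc sd se)
      (topStrand c d sc sd).reverse (middleStrand c e sc se).reverse
      (bottomStrand d e sc sd se).reverse := by
  intro G _ u x y z hT hM hN
  refine ⟨if se then y else step u y ⟨c, false, sc⟩, ?_⟩
  cases sc <;> cases sd <;> cases se <;>
    simp_all [topStrand, middleStrand, bottomStrand, step, mul_assoc]

theorem triangleMove_symm (hce : c ≠ e) (hde : d ≠ e) :
    TriangleMove e (topStrand c d sc sd).reverse (middleStrand c e sc se).reverse
      (bottomStrand d e sc sd se).reverse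
      (topStrand c d sc sd) (middleStrand c e sc se) (bottomStrand d e sc sd se) := by
  intro G _ u x y z hT hM hN
  refine ⟨if se then step u y ⟨c, false, sc⟩ else y, ?_⟩
  cases sc <;> cases sd <;> cases se <;>
    simp_all [topStrand, middleStrand, bottomStrand, step, mul_assoc]

theorem triangleDetermined :
    TriangleDetermined (topStrand c d sc sd) (middleStrand c e sc se)
      (bottomStrand d e sc sd se) := by
  intro G _ u v x y z h1 h2 h3 h4 h5 h6 h7 h8 h9
  cases sc <;> cases sd <;> cases se <;>
    simp_all [topStrand, middleStrand, bottomStrand, step, mul_assoc]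

theorem triangleDetermined_reverse :
    TriangleDetermined (topStrand c d sc sd).reverse (middleStrand c e sc se).reverse
      (bottomStrand d e sc sd se).reverse := by
  intro G _ u v x y z h1 h2 h3 h4 h5 h6 h7 h8 h9
  cases sc <;> cases sd <;> cases se <;>
    simp_all [topStrand, middleStrand, bottomStrand, step, mul_assoc]

end Strands

end GaussCode

/-! ### The isomorphism induced by a move -/

namespace GaussCode

theorem map_nodup_of_perm {l l' : List Passage} (h : l.Perm l')
    (hl : (l.map fun p => (p.crossing, p.isOver)).Nodup) :
    (l'.map fun p => (p.crossing, p.isOver)).Nodup :=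
  (h.map _).nodup hl

variable {c d e : ℕ} (sc sd se : Bool)

/-- The crossings of the triangle of a third move are distinct from each other and from all
others. -/
theorem triangle_crossings {T M N A : List Passage}
    (hT : T.Perm (topStrand c d sc sd)) (hM : M.Perm (middleStrand c e sc se))
    (hN : N.Perm (bottomStrand d e sc sd se))
    (h : ((T ++ M ++ N ++ A).map fun p => (p.crossing, p.isOver)).Nodup) :
    c ≠ e ∧ d ≠ e ∧ ∀ p ∈ A, p.crossing ≠ e := by
  have hTp : T.Perm [⟨c, true, sc⟩, ⟨d, true, sd⟩] := by
    refine hT.trans ?_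
    unfold topStrand
    split_ifs
    · exact .refl _
    · exact .swap ..
  have hMp : M.Perm [⟨c, false, sc⟩, ⟨e, true, se⟩] := by
    refine hM.trans ?_
    unfold middleStrand
    split_ifs
    · exact .refl _
    · exact .swap ..
  have hNp : N.Perm [⟨d, false, sd⟩, ⟨e, false, se⟩] := by
    refine hN.trans ?_
    unfold bottomStrand
    split_ifs
    · exact .refl _
    · exact .swap ..
  have h' := map_nodup_of_perm (((hTp.append hMp).append hNp).append_right A) h
  refine ⟨?_, ?_, crossing_ne_of_nodup h' fun o => ?_⟩
  · rintro rfl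
    simp at h'
  · rintro rfl
    simp at h'
  · cases o <;> simp

/-- The crossings of the bigon of a second move are distinct from each other and from all
others. -/
theorem bigon_crossings (o s : Bool) {Y A B : List Passage}
    (hY : Y.Perm [⟨c, !o, s⟩, ⟨d, !o, !s⟩])
    (h : ((([⟨c, o, s⟩, ⟨d, o, !s⟩] : List Passage) ++ A ++ Y ++ B).map
      fun p : Passage => (p.crossing, p.isOver)).Nodup) :
    c ≠ d ∧ ∀ p ∈ A ++ B, p.crossing ≠ c ∧ p.crossing ≠ d := by
  have hp : (([⟨c, o, s⟩, ⟨d, o, !s⟩] : List Passage) ++ A ++ Y ++ B).Perm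
      (([⟨c, o, s⟩, ⟨d, o, !s⟩] : List Passage) ++ Y ++ (A ++ B)) := by
    rw [List.perm_iff_count]
    intro a
    simp only [List.count_append]
    omega
  have hn := map_nodup_of_perm (hp.trans ((hY.append_left _).append_right _)) h
  have h1 := crossing_ne_of_nodup hn (c := c) (by intro o'; cases o <;> cases o' <;> simp)
  have h2 := crossing_ne_of_nodup hn (c := d) (by intro o'; cases o <;> cases o' <;> simp)
  refine ⟨?_, fun p hp => ⟨h1 p hp, h2 p hp⟩⟩
  rintro rfl
  simp at hn

end GaussCode

namespace ReidemeisterMove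

open GaussCode

theorem perm_strands_left (T A M B N C : List Passage) :
    (T ++ A ++ M ++ B ++ N ++ C).Perm (T ++ M ++ N ++ (A ++ B ++ C)) := by
  rw [List.perm_iff_count]
  intro a
  simp only [List.count_append]
  omega

theorem perm_strands_swap (T A M B N C : List Passage) :
    (T ++ A ++ N ++ B ++ M ++ C).Perm (T ++ M ++ N ++ (A ++ B ++ C)) := by
  rw [List.perm_iff_count]
  intro a
  simp only [List.count_append]
  omega

/-- Colourings can be transported along a Reidemeister move in both directions, and are determined
by the colours outside the disc of the move. -/
theorem colorings {l l' : List Passage} {E : ℕ → ℕ → Prop} (h : ReidemeisterMove l l' E)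
    (hl : (l.map fun p => (p.crossing, p.isOver)).Nodup)
    (hl' : (l'.map fun p => (p.crossing, p.isOver)).Nodup) :
    (Transfers l l' E ∧ Transfers l' l fun k' k => E k k') ∧
    ((Determines l fun k => ∃ k', E k k') ∧ Determines l' fun k' => ∃ k, E k k') := by
  cases h with
  | basePoint A B =>
    refine ⟨⟨transfers_basePoint A B, ?_⟩, .of_forall fun k hk => ?_, .of_forall fun k hk => ?_⟩
    · intro G _ u x hu
      obtain ⟨v, y, hv, hE⟩ := transfers_basePoint B A G u x hu
      exact ⟨v, y, hv, fun k k' hk => hE k k' hk.symm⟩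
    · rw [List.length_append] at hk
      rcases le_total k A.length with h | h
      · exact ⟨_, .inl ⟨h, rfl⟩⟩
      · exact ⟨k - A.length, .inr ⟨by omega, by omega⟩⟩
    · rw [List.length_append] at hk
      rcases le_total k B.length with h | h
      · exact ⟨_, .inr ⟨h, rfl⟩⟩
      · exact ⟨k - B.length, .inl ⟨by omega, by omega⟩⟩
  | rename f l =>
    refine ⟨⟨transfers_rename f l, transfers_rename_symm f l⟩, .of_forall fun k hk => ⟨k, hk, rfl⟩,
      .of_forall fun k hk => ⟨k, by simpa using hk, rfl⟩⟩
  | r1 c o s l =>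
    exact ⟨⟨transfers_r1 c o s l hl', transfers_r1_symm c o s l⟩,
      .of_forall fun k hk => ⟨_, .inr ⟨hk, rfl⟩⟩, determines_r1 c o s l⟩
  | r2Parallel c d o s A B =>
    obtain ⟨hcd, hne⟩ := bigon_crossings o s (.refl _) hl'
    refine ⟨⟨transfers_bigon A B (isBigon_parallel o s) c d
        (exists_agrees_bigon o s hcd (.inl rfl)) hne,
      transfers_bigon_symm A B (isBigon_parallel o s)⟩, .of_forall fun k hk => ?_,
      determines_bigon A B (isBigon_parallel o s)⟩
    rw [List.length_append] at hk
    rcases le_total k A.length with h | h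
    · exact ⟨_, .inr (.inl ⟨h, rfl⟩)⟩
    · exact ⟨_, .inr (.inr ⟨h, hk, rfl⟩)⟩
  | r2Antiparallel c d o s A B =>
    obtain ⟨hcd, hne⟩ := bigon_crossings o s (.swap ..) hl'
    refine ⟨⟨transfers_bigon A B (isBigon_antiparallel o s) c d
        (exists_agrees_bigon o s hcd (.inr rfl)) hne,
      transfers_bigon_symm A B (isBigon_antiparallel o s)⟩, .of_forall fun k hk => ?_,
      determines_bigon A B (isBigon_antiparallel o s)⟩
    rw [List.length_append] at hk
    rcases le_total k A.length with h | h
    · exact ⟨_, .inr (.inl ⟨h, rfl⟩)⟩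
    · exact ⟨_, .inr (.inr ⟨h, hk, rfl⟩)⟩
  | r3TopMiddleBottom c d e sc sd se A B C =>
    obtain ⟨hce, hde, he⟩ := triangle_crossings sc sd se (.refl _) (.refl _) (.refl _)
      (map_nodup_of_perm (perm_strands_left ..) hl)
    have lT : (topStrand c d sc sd).length = 2 := length_topStrand sc sd
    have lM : (middleStrand c e sc se).length = 2 := length_middleStrand sc se
    have lN : (bottomStrand d e sc sd se).length = 2 := length_bottomStrand sc sd se
    have lT' := (List.length_reverse (as := topStrand c d sc sd)).trans lT
    have lM' := (List.length_reverse (as := middleStrand c e sc se)).trans lM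
    have lN' := (List.length_reverse (as := bottomStrand d e sc sd se)).trans lN
    refine ⟨⟨transfers_triangle A B C (triangleMove sc sd se hce hde) lT lM lN lT' lM' lN' he,
      ?_⟩, ?_, ?_⟩
    · intro G _ u x hu
      obtain ⟨v, y, hv, hE⟩ := transfers_triangle A B C (triangleMove_symm sc sd se hce hde)
        lT' lM' lN' lT lM lN he G u x hu
      exact ⟨v, y, hv, fun k k' hk => hE k k' ⟨hk.1.symm, hk.1 ▸ hk.2⟩⟩
    · intro G _ u v x y hu hv hS
      exact determines_triangle A B C (triangleDetermined sc sd se) lT lM lN G u v x y hu hv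
        fun k hk => hS k ⟨k, rfl, hk⟩
    · intro G _ u v x y hu hv hS
      exact determines_triangle A B C (triangleDetermined_reverse sc sd se) lT' lM' lN' G u v x y
        hu hv fun k hk => hS k ⟨k, rfl, hk⟩
  | r3TopBottomMiddle c d e sc sd se A B C =>
    obtain ⟨hce, hde, he⟩ := triangle_crossings sc sd se (.refl _) (.refl _) (.refl _)
      (map_nodup_of_perm (perm_strands_swap ..) hl)
    have lT : (topStrand c d sc sd).length = 2 := length_topStrand sc sd
    have lM : (middleStrand c e sc se).length = 2 := length_middleStrand sc se
    have lN : (bottomStrand d e sc sd se).length = 2 := length_bottomStrand sc sd se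
    have lT' := (List.length_reverse (as := topStrand c d sc sd)).trans lT
    have lM' := (List.length_reverse (as := middleStrand c e sc se)).trans lM
    have lN' := (List.length_reverse (as := bottomStrand d e sc sd se)).trans lN
    refine ⟨⟨transfers_triangle A B C (triangleMove sc sd se hce hde).swap lT lN lM lT' lN' lM' he,
      ?_⟩, ?_, ?_⟩
    · intro G _ u x hu
      obtain ⟨v, y, hv, hE⟩ := transfers_triangle A B C (triangleMove_symm sc sd se hce hde).swap
        lT' lN' lM' lT lN lM he G u x hu
      exact ⟨v, y, hv, fun k k' hk => hE k k' ⟨hk.1.symm, hk.1 ▸ hk.2⟩⟩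
    · intro G _ u v x y hu hv hS
      exact determines_triangle A B C (triangleDetermined sc sd se).swap lT lN lM G u v x y hu hv
        fun k hk => hS k ⟨k, rfl, hk⟩
    · intro G _ u v x y hu hv hS
      exact determines_triangle A B C (triangleDetermined_reverse sc sd se).swap lT' lN' lM' G u v
        x y hu hv fun k hk => hS k ⟨k, rfl, hk⟩

/-- Related gaps lie within the codes. -/
theorem le_length {l l' : List Passage} {E : ℕ → ℕ → Prop} (h : ReidemeisterMove l l' E)
    {k k' : ℕ} (hE : E k k') : k ≤ l.length ∧ k' ≤ l'.length := by
  cases h with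
  | basePoint A B => simp only [List.length_append]; omega
  | rename f l => simp only [List.length_map]; omega
  | r1 c o s l => simp only [List.length_append, List.length_cons, List.length_nil]; omega
  | r2Parallel c d o s A B =>
    simp only [List.length_append, List.length_cons, List.length_nil]; omega
  | r2Antiparallel c d o s A B =>
    simp only [List.length_append, List.length_cons, List.length_nil]; omega
  | r3TopMiddleBottom c d e sc sd se A B C =>
    simp only [List.length_append, List.length_reverse, length_topStrand, length_middleStrand,
      length_bottomStrand]
    omega
  | r3TopBottomMiddle c d e sc sd se A B C =>
    simp only [List.length_append, List.length_reverse, length_topStrand, length_middleStrand,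
      length_bottomStrand]
    omega

theorem exists_gap {l l' : List Passage} {E : ℕ → ℕ → Prop} (h : ReidemeisterMove l l' E) :
    ∃ k k', E k k' := by
  cases h with
  | basePoint A B => exact ⟨0, _, .inl ⟨Nat.zero_le _, rfl⟩⟩
  | rename f l => exact ⟨0, 0, Nat.zero_le _, rfl⟩
  | r1 c o s l => exact ⟨0, 0, .inl ⟨rfl, rfl⟩⟩
  | r2Parallel c d o s A B => exact ⟨0, 0, .inl ⟨rfl, rfl⟩⟩
  | r2Antiparallel c d o s A B => exact ⟨0, 0, .inl ⟨rfl, rfl⟩⟩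
  | r3TopMiddleBottom c d e sc sd se A B C => exact ⟨0, 0, rfl, by omega⟩
  | r3TopBottomMiddle c d e sc sd se A B C => exact ⟨0, 0, rfl, by omega⟩

end ReidemeisterMove

namespace KnotDiagram

open GaussCode

variable {D D' : KnotDiagram} {E : ℕ → ℕ → Prop}

/-- A homomorphism is determined by its values at gaps that determine all colourings. -/
theorem hom_ext_of_determines {G : Type} [Group G] {S : ℕ → Prop} (hS : Determines D.code S)
    (hle : ∀ k, S k → k ≤ D.code.length) {f g : D.group →* G}
    (h : ∀ k, S k → f (D.meridian k) = g (D.meridian k)) : f = g := by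
  apply D.hom_ext_meridian
  intro k hk
  rw [← D.walk_overColor f hk, ← D.walk_overColor g hk]
  refine hS G _ _ _ _ (D.isColoring_overColor f) (D.isColoring_overColor g) (fun k hk => ?_) k hk
  rw [D.walk_overColor f (hle k hk), D.walk_overColor g (hle k hk), h k hk]

/-- Transport of the universal colouring of `D'` gives a homomorphism from the group of `D`. -/
theorem exists_hom_of_transfers (h : Transfers D'.code D.code fun k' k => E k k')
    (hle : ∀ k k', E k k' → k ≤ D.code.length ∧ k' ≤ D'.code.length) :
    ∃ f : D.group →* D'.group, ∀ k k', E k k' → f (D.meridian k) = D'.meridian k' := by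
  obtain ⟨u, x, hu, hE⟩ := h D'.group _ _ (D'.isColoring_overColor (MonoidHom.id _))
  refine ⟨ofColoring hu, fun k k' hk => ?_⟩
  rw [ofColoring_meridian, ← hE k' k hk, D'.walk_overColor _ (hle k k' hk).2]
  rfl

/-- The isomorphism is obtained by transporting the universal colourings in both directions. That
the composites are the identity, and that the isomorphism is unique, holds because a colouring is
determined by its colours outside the disc. -/
theorem existsUnique_matchesMeridians (h : ReidemeisterMove D.code D'.code E) :
    ∃! φ : D.group ≃* D'.group, D.MatchesMeridians D' E φ := by
  obtain ⟨⟨h1, h2⟩, h3, h4⟩ := h.colorings D.nodup D'.nodup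
  have hle : ∀ k k', E k k' → k ≤ D.code.length ∧ k' ≤ D'.code.length := fun _ _ => h.le_length
  obtain ⟨f, hf⟩ := exists_hom_of_transfers h2 hle
  obtain ⟨g, hg⟩ := exists_hom_of_transfers (E := fun k' k => E k k') h1
    fun k' k hk => (hle k k' hk).symm
  have hgf : g.comp f = MonoidHom.id _ := by
    refine hom_ext_of_determines h3 (fun k ⟨k', hk⟩ => (hle k k' hk).1) fun k ⟨k', hk⟩ => ?_
    rw [MonoidHom.comp_apply, hf k k' hk, hg k' k hk]
    rfl
  have hfg : f.comp g = MonoidHom.id _ := by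
    refine hom_ext_of_determines h4 (fun k' ⟨k, hk⟩ => (hle k k' hk).2) fun k' ⟨k, hk⟩ => ?_
    rw [MonoidHom.comp_apply, hg k' k hk, hf k k' hk]
    rfl
  refine ⟨f.toMulEquiv g hgf hfg, hf, fun ψ hψ => ?_⟩
  apply MulEquiv.toMonoidHom_injective
  refine hom_ext_of_determines h3 (fun k ⟨k', hk⟩ => (hle k k' hk).1) fun k ⟨k', hk⟩ => ?_
  exact (hψ k k' hk).trans (hf k k' hk).symm

end KnotDiagram

/-! ### Labellings of the faces -/

/-- Simple connectedness of a cellular sphere. If `h` labels the edges by elements of a group so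
that, for every labelling of the faces, the edges at which the face labels on both sides do not
differ by `h` never meet a vertex exactly once, then there is a labelling of the faces without such
edges. A labelling with as few bad edges as possible works: a face function constant across the
good edges is constant, as otherwise the labels on one of its level sets could be translated to
repair an edge; but a nonzero cycle of bad edges would be the coboundary of such a function. -/
theorem exists_face_labelling {P V F G : Type*} [Fintype P] [Fintype V] [Fintype F]
    [DecidableEq V] [Group G] (tail head : P → V) (left right : P → F)
    (euler : Fintype.card V + Fintype.card F = Fintype.card P + 2)
    (hV : ∀ ψ : V → ℚ, (∀ e, ψ (head e) = ψ (tail e)) → ∀ v w, ψ v = ψ w)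
    (hF : ∀ φ : F → ℚ, (∀ e, φ (left e) = φ (right e)) → ∀ v w, φ v = φ w)
    (orth : ∀ (φ : F → ℚ) (ψ : V → ℚ),
      ∑ e, (φ (left e) - φ (right e)) * (ψ (head e) - ψ (tail e)) = 0)
    (h : P → G)
    (hlone : ∀ (g : F → G) (B : Finset P), (∀ e, e ∈ B ↔ g (right e) ≠ g (left e) * h e) →
      ∀ v, (B.filter fun e => tail e = v).card + (B.filter fun e => head e = v).card ≠ 1) :
    ∃ g : F → G, ∀ e, g (right e) = g (left e) * h e := by
  classical
  let bad : (F → G) → Finset P := fun g =>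
    Finset.univ.filter fun e => g (right e) ≠ g (left e) * h e
  have mem_bad : ∀ g e, e ∈ bad g ↔ g (right e) ≠ g (left e) * h e := fun g e => by simp [bad]
  obtain ⟨g, hg⟩ : ∃ g, ∀ g', (bad g).card ≤ (bad g').card := by
    obtain ⟨g, hg⟩ := Nat.sInf_mem (Set.range_nonempty fun g => (bad g).card)
    exact ⟨g, fun g' => hg.trans_le (Nat.sInf_le ⟨g', rfl⟩)⟩
  refine ⟨g, ?_⟩
  by_contra! hcon
  obtain ⟨e₀, he₀⟩ := hcon
  obtain ⟨z, hz0, hzB, hz⟩ := exists_cycle_of_no_leaf tail head (bad g)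
    ⟨e₀, (mem_bad g e₀).2 he₀⟩ (hlone g (bad g) (mem_bad g))
  obtain ⟨φ, hφ⟩ := exists_face_potential tail head left right euler hV hF orth z hz
  have hgood : ∀ e, g (right e) = g (left e) * h e → φ (left e) = φ (right e) := by
    intro e he
    rw [← sub_eq_zero, ← hφ]
    exact hzB e fun hb => (mem_bad g e).1 hb he
  have hconst : ∀ e, φ (left e) = φ (right e) := by
    intro e
    by_contra hne
    -- translate the labels on the level set of `φ` through the face on the right of `e`
    let g' : F → G := fun f =>
      if φ f = φ (right e) then g (left e) * h e * (g (right e))⁻¹ * g f else g f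
    have hlt : bad g' ⊂ bad g := by
      rw [Finset.ssubset_iff_of_subset]
      · refine ⟨e, (mem_bad g e).2 fun hb => hne (hgood e hb), fun hb => ?_⟩
        rw [mem_bad] at hb
        apply hb
        simp [g', hne]
      · intro a ha
        rw [mem_bad] at ha ⊢
        intro hb
        apply ha
        have := hgood a hb
        simp only [g', this, hb]
        split_ifs
        · simp only [mul_assoc]
        · rfl
    exact absurd (hg g') (not_le.2 (Finset.card_lt_card hlt))
  exact hz0 (funext fun e => by rw [hφ, hconst, sub_self]; rfl)

/-! ### The diagram as a cellular sphere -/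

namespace Passage

theorem partner_partner (p : Passage) : p.partner.partner = p := by
  cases p
  simp [partner]

theorem partner_ne (p : Passage) : p.partner ≠ p := by
  intro h
  have := congrArg isOver h
  simp [partner] at this

end Passage

namespace GaussCode

theorem flip_flip (l : List Passage) (d : HalfEdge) : flip l (flip l d) = d := by
  obtain ⟨p, _ | _⟩ := d <;> simp [flip]

theorem flip_mem {l : List Passage} {d : HalfEdge} (h : d.1 ∈ l) : (flip l d).1 ∈ l := by
  obtain ⟨p, _ | _⟩ := d
  · have := List.formPerm_mem_iff_mem (l := l) (x := l.formPerm.symm p)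
    rw [Equiv.apply_symm_apply] at this
    exact this.1 h
  · exact List.formPerm_apply_mem_of_mem h

theorem rotate_rotate (p : Passage) (b : Bool) : rotate (rotate (p, b)) = (p, !b) := by
  obtain ⟨c, o, s⟩ := p
  cases b <;> cases o <;> cases s <;> rfl

end GaussCode

namespace KnotDiagram

open GaussCode

variable (D : KnotDiagram)

/-- The edges of the diagram, recorded by the passages at their starts. -/
abbrev Edge : Type := {p : Passage // p ∈ D.code}

/-- The crossings of the diagram, recorded by the under-passages. -/
abbrev Crossing : Type := {p : Passage // p ∈ unders D.code}

/-- The half-edges of the diagram. -/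
abbrev Half : Type := {d : HalfEdge // d.1 ∈ D.code}

/-- The faces of the diagram. -/
abbrev Face : Type :=
  Quot fun d d' : D.Half => d'.1 = rotate (flip D.code d)

/-- The crossing at a passage. -/
def crossingOf (p : D.Edge) : D.Crossing :=
  if h : p.1.isOver = true then
    ⟨p.1.partner, List.mem_filter.2 ⟨D.paired _ p.2, by simp [Passage.partner, h]⟩⟩
  else ⟨p.1, List.mem_filter.2 ⟨p.2, by simpa using h⟩⟩

/-- The other passage through the same crossing. -/
def partner (p : D.Edge) : D.Edge := ⟨p.1.partner, D.paired _ p.2⟩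

/-- The next edge along the knot. -/
def next : Equiv.Perm D.Edge :=
  D.code.formPerm.subtypePerm fun _ => List.formPerm_mem_iff_mem

variable {D}

theorem partner_partner (p : D.Edge) : D.partner (D.partner p) = p :=
  Subtype.ext p.1.partner_partner

theorem crossingOf_partner (p : D.Edge) : D.crossingOf (D.partner p) = D.crossingOf p := by
  rcases h : p.1.isOver with _ | _
  · have h' : (D.partner p).1.isOver = true := by simp [partner, Passage.partner, h]
    rw [crossingOf, crossingOf, dif_pos h', dif_neg (by simp [h])]
    exact Subtype.ext p.1.partner_partner
  · have h' : (D.partner p).1.isOver = false := by simp [partner, Passage.partner, h]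
    rw [crossingOf, crossingOf, dif_neg (by simp [h']), dif_pos h]
    rfl

theorem crossingOf_under (v : D.Crossing) :
    D.crossingOf ⟨v.1, (List.mem_filter.1 v.2).1⟩ = v := by
  have h := (List.mem_filter.1 v.2).2
  rw [crossingOf, dif_neg (by simpa using h)]

theorem crossingOf_eq_iff (p q : D.Edge) :
    D.crossingOf p = D.crossingOf q ↔ p = q ∨ p = D.partner q := by
  constructor
  · intro h
    have key : ∀ r : D.Edge, r.1 = (D.crossingOf r).1 ∨ r.1.partner = (D.crossingOf r).1 := by
      intro r
      unfold crossingOf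
      split_ifs
      · exact .inr rfl
      · exact .inl rfl
    rcases key p with hp | hp <;> rcases key q with hq | hq <;> rw [h, ← hq] at hp
    · exact .inl (Subtype.ext hp)
    · exact .inr (Subtype.ext hp)
    · refine .inr (Subtype.ext ?_)
      rw [← p.1.partner_partner, hp]
      rfl
    · refine .inl (Subtype.ext ?_)
      rw [← p.1.partner_partner, hp, Passage.partner_partner]
  · rintro (rfl | rfl)
    · rfl
    · exact crossingOf_partner q

theorem card_edge : Fintype.card D.Edge = 2 * Fintype.card D.Crossing := by
  have e : D.Edge ≃ D.Crossing × Bool :=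
    { toFun := fun p => (D.crossingOf p, p.1.isOver)
      invFun := fun x => if x.2 then D.partner ⟨x.1.1, (List.mem_filter.1 x.1.2).1⟩
        else ⟨x.1.1, (List.mem_filter.1 x.1.2).1⟩
      left_inv := by
        rintro ⟨p, hp⟩
        rcases h : p.isOver with _ | _
        · simp [crossingOf, h]
        · apply Subtype.ext
          simp [crossingOf, h, partner, Passage.partner_partner]
      right_inv := by
        rintro ⟨v, b⟩
        have h := (List.mem_filter.1 v.2).2
        simp only [Bool.not_eq_true'] at h
        cases b
        · simp [crossingOf_under, h]
        · refine Prod.ext ?_ (by simp [partner, Passage.partner, h])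
          exact (crossingOf_partner _).trans (crossingOf_under v) }
  rw [Fintype.card_congr e, Fintype.card_prod, Fintype.card_bool, mul_comm]

theorem card_crossing : Fintype.card D.Crossing = (unders D.code).length := by
  rw [Fintype.card_of_subtype (unders D.code).toFinset (by simp)]
  exact List.toFinset_card_of_nodup (l := unders D.code) (D.code_nodup.filter _)

instance : Finite D.Half :=
  Finite.of_injective (fun d => ((⟨d.1.1, d.2⟩, d.1.2) : D.Edge × Bool)) fun _ _ h =>
    Subtype.ext (Prod.ext (congrArg (fun x => x.1.1) h) (congrArg (fun x => x.2) h))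

instance : Finite D.Face := Quot.finite _

instance : Fintype D.Face := Fintype.ofFinite _

theorem euler (hne : D.code ≠ []) :
    Fintype.card D.Crossing + Fintype.card D.Face = Fintype.card D.Edge + 2 := by
  have h := D.planar.resolve_left hne
  rw [faceCount, Nat.card_eq_fintype_card] at h
  rw [card_edge, h, card_crossing]
  ring

/-- The half-edge by which a passage leaves its crossing. -/
def outHalf (p : D.Edge) : D.Half := ⟨(p.1, true), p.2⟩

/-- The half-edge by which a crossing is entered at a passage. -/
def inHalf (p : D.Edge) : D.Half := ⟨(p.1, false), p.2⟩

/-- The face to which a half-edge belongs. -/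
def face (d : D.Half) : D.Face := Quot.mk _ d

/-- The next half-edge around the crossing. -/
def rot (d : D.Half) : D.Half := ⟨rotate d.1, D.paired _ d.2⟩

/-- The other half of the edge. -/
def opp (d : D.Half) : D.Half := ⟨flip D.code d.1, flip_mem d.2⟩

theorem face_opp (d : D.Half) : face (opp d) = face (rot d) := by
  apply Quot.sound
  change rotate d.1 = rotate (flip D.code (flip D.code d.1))
  rw [GaussCode.flip_flip]

theorem opp_opp (d : D.Half) : opp (opp d) = d := Subtype.ext (GaussCode.flip_flip _ _)

theorem opp_outHalf (p : D.Edge) : opp (outHalf p) = inHalf (D.next p) := rfl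

theorem opp_inHalf (p : D.Edge) : opp (inHalf (D.next p)) = outHalf p := by
  rw [← opp_outHalf, opp_opp]

theorem half_cases (d : D.Half) : ∃ p, d = outHalf p ∨ d = inHalf p := by
  obtain ⟨⟨p, _ | _⟩, hp⟩ := d
  · exact ⟨⟨p, hp⟩, .inr rfl⟩
  · exact ⟨⟨p, hp⟩, .inl rfl⟩

theorem rot_rot_outHalf (p : D.Edge) : rot (rot (outHalf p)) = inHalf p :=
  Subtype.ext (rotate_rotate p.1 true)

theorem rot_rot_inHalf (p : D.Edge) : rot (rot (inHalf p)) = outHalf p :=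
  Subtype.ext (rotate_rotate p.1 false)

/-- Turning by one step sends the two half-edges at a passage to those at the other passage. -/
theorem rot_cases (p : D.Edge) :
    (rot (outHalf p) = outHalf (D.partner p) ∧ rot (inHalf p) = inHalf (D.partner p)) ∨
      (rot (outHalf p) = inHalf (D.partner p) ∧ rot (inHalf p) = outHalf (D.partner p)) := by
  by_cases h : p.1.isOver = p.1.positive
  · left
    constructor <;> apply Subtype.ext <;> simp [rot, outHalf, inHalf, rotate, h, partner]
  · right
    constructor <;> apply Subtype.ext <;> simp [rot, outHalf, inHalf, rotate, h, partner]

/-- A property of edges that passes to the next edge holds for all edges once it holds for one. -/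
theorem edge_induction {C : D.Edge → Prop} (h : ∀ p, C p → C (D.next p)) {p : D.Edge} (hp : C p)
    (q : D.Edge) : C q := by
  obtain ⟨p, hpm⟩ := p
  obtain ⟨q, hqm⟩ := q
  have key : ∀ n (i : ℕ) (hi : i < D.code.length), C ⟨D.code[i], List.getElem_mem hi⟩ →
      C ⟨D.code[(i + n) % D.code.length]'(Nat.mod_lt _ (by omega)), List.getElem_mem _⟩ := by
    intro n
    induction n with
    | zero =>
      intro i hi hC
      simpa [Nat.mod_eq_of_lt hi] using hC
    | succ n ih =>
      intro i hi hC
      have h1 := h _ (ih i hi hC)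
      convert h1 using 2
      have h2 := List.formPerm_apply_getElem D.code D.code_nodup ((i + n) % D.code.length)
        (Nat.mod_lt _ (by omega))
      change _ = D.code.formPerm _
      rw [h2]
      simp [add_assoc]
  obtain ⟨i, hi, rfl⟩ := List.mem_iff_getElem.1 hpm
  obtain ⟨j, hj, rfl⟩ := List.mem_iff_getElem.1 hqm
  have h1 := key (D.code.length - i + j) i hi hp
  have h2 : (i + (D.code.length - i + j)) % D.code.length = j := by
    rw [← add_assoc, Nat.add_sub_cancel' hi.le, Nat.add_mod_left, Nat.mod_eq_of_lt hj]
  simpa only [h2] using h1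

theorem crossing_connected (ψ : D.Crossing → ℚ)
    (h : ∀ e, ψ (D.crossingOf (D.next e)) = ψ (D.crossingOf e)) (v w : D.Crossing) :
    ψ v = ψ w := by
  rw [← crossingOf_under v, ← crossingOf_under w]
  exact edge_induction (C := fun e => ψ (D.crossingOf e) = ψ (D.crossingOf ⟨w.1, _⟩))
    (fun p hp => (h p).trans hp) rfl _

theorem face_connected (φ : D.Face → ℚ)
    (h : ∀ e, φ (face (outHalf e)) = φ (face (opp (outHalf e)))) (f f' : D.Face) : φ f = φ f' := by
  have hopp : ∀ d : D.Half, φ (face (opp d)) = φ (face d) := by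
    intro d
    obtain ⟨p, rfl | rfl⟩ := half_cases d
    · exact (h p).symm
    · obtain ⟨q, rfl⟩ := D.next.surjective p
      rw [opp_inHalf, h, opp_outHalf]
  have hrot : ∀ d : D.Half, φ (face (rot d)) = φ (face d) := fun d => by
    rw [← face_opp, hopp]
  have hin : ∀ p : D.Edge, φ (face (inHalf p)) = φ (face (outHalf p)) := fun p => by
    rw [← rot_rot_outHalf, hrot, hrot]
  have hnext : ∀ p : D.Edge, φ (face (outHalf (D.next p))) = φ (face (outHalf p)) := fun p => by
    rw [← hin, ← opp_outHalf, hopp]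
  have key : ∀ d d' : D.Half, φ (face d) = φ (face d') := by
    intro d d'
    obtain ⟨p, hp⟩ := half_cases d
    obtain ⟨q, hq⟩ := half_cases d'
    have h1 : φ (face d) = φ (face (outHalf p)) := by
      rcases hp with rfl | rfl
      · rfl
      · exact hin p
    have h2 : φ (face d') = φ (face (outHalf q)) := by
      rcases hq with rfl | rfl
      · rfl
      · exact hin q
    rw [h1, h2]
    exact edge_induction (C := fun e => φ (face (outHalf e)) = φ (face (outHalf q)))
      (fun p hp => (hnext p).trans hp) rfl _
  induction f using Quot.ind
  induction f' using Quot.ind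
  exact key _ _

/-- Coboundaries of face functions are cycles: at each crossing the contributions telescope. -/
theorem face_orthogonal (φ : D.Face → ℚ) (ψ : D.Crossing → ℚ) :
    ∑ e, (φ (face (outHalf e)) - φ (face (opp (outHalf e)))) *
      (ψ (D.crossingOf (D.next e)) - ψ (D.crossingOf e)) = 0 := by
  let a : D.Edge → ℚ := fun e => φ (face (outHalf e))
  let b : D.Edge → ℚ := fun e => φ (face (inHalf e))
  have h1 : ∀ e, (φ (face (outHalf e)) - φ (face (opp (outHalf e)))) *
      (ψ (D.crossingOf (D.next e)) - ψ (D.crossingOf e)) =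
      (φ (face (rot (inHalf (D.next e)))) - b (D.next e)) * ψ (D.crossingOf (D.next e)) +
        (φ (face (rot (outHalf e))) - a e) * ψ (D.crossingOf e) := by
    intro e
    rw [← face_opp, opp_inHalf, ← face_opp, opp_outHalf]
    simp only [a, b]
    ring
  have h2 : ∑ e, (a (D.partner e) + b (D.partner e)) * ψ (D.crossingOf e) =
      ∑ e, (a e + b e) * ψ (D.crossingOf e) := by
    let τ : Equiv.Perm D.Edge := ⟨D.partner, D.partner, partner_partner, partner_partner⟩
    rw [← Equiv.sum_comp τ fun e => (a e + b e) * ψ (D.crossingOf e)]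
    refine Finset.sum_congr rfl fun e _ => ?_
    change _ = (a (D.partner e) + b (D.partner e)) * ψ (D.crossingOf (D.partner e))
    rw [crossingOf_partner]
  rw [Finset.sum_congr rfl fun e _ => h1 e, Finset.sum_add_distrib,
    Equiv.sum_comp D.next fun e => (φ (face (rot (inHalf e))) - b e) * ψ (D.crossingOf e),
    ← Finset.sum_add_distrib, ← sub_eq_zero.2 h2, ← Finset.sum_sub_distrib]
  refine Finset.sum_congr rfl fun e _ => ?_
  rcases rot_cases e with ⟨h, h'⟩ | ⟨h, h'⟩ <;> rw [h, h'] <;> simp only [a, b] <;> ring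

end KnotDiagram

namespace KnotDiagram

open GaussCode

variable {D : KnotDiagram}

/-- The position of a passage in the code. -/
def pos (p : D.Edge) : ℕ := D.code.idxOf p.1

theorem getElem?_pos (p : D.Edge) : D.code[pos p]? = some p.1 := D.getElem?_idxOf p.2

theorem pos_lt (p : D.Edge) : pos p < D.code.length := List.idxOf_lt_length_of_mem p.2

theorem arcAt_pos_next (p : D.Edge) : D.arcAt (pos (D.next p)) = D.arcAt (pos p + 1) := by
  have h1 := List.formPerm_apply_getElem D.code D.code_nodup (pos p) (pos_lt p)
  have h2 : D.code[pos p]'(pos_lt p) = p.1 := List.getElem_idxOf (pos_lt p)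
  have hlt : (pos p + 1) % D.code.length < D.code.length :=
    Nat.mod_lt _ (Nat.zero_lt_of_lt (pos_lt p))
  have h3 : pos (D.next p) = (pos p + 1) % D.code.length := by
    change D.code.idxOf (D.code.formPerm p.1) = _
    conv_lhs => rw [← h2, h1]
    exact D.code_nodup.idxOf_getElem _ hlt
  rw [h3]
  rcases (Nat.succ_le_of_lt (pos_lt p)).lt_or_eq with h | h
  · rw [Nat.mod_eq_of_lt h]
  · have h' : pos p + 1 = D.code.length := h
    rw [h', Nat.mod_self, D.arcAt_length]

/-- The meridian of the edge that leaves the crossing at a passage. -/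
def mer (p : D.Edge) : D.group := D.meridian (pos p + 1)

theorem mer_over {p : D.Edge} (hp : p.1.isOver = true) : D.meridian (pos p) = mer p :=
  (D.meridian_succ_over (getElem?_pos p) hp).symm

theorem mer_under {p : D.Edge} (hp : p.1.isOver = false) :
    mer p = if p.1.positive then (mer (D.partner p))⁻¹ * D.meridian (pos p) * mer (D.partner p)
      else mer (D.partner p) * D.meridian (pos p) * (mer (D.partner p))⁻¹ := by
  have h : (D.partner p).1.isOver = true := by simp [partner, Passage.partner, hp]
  rw [← mer_over h]
  exact D.meridian_succ_under (getElem?_pos p) hp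

theorem meridian_pos_next (p : D.Edge) : D.meridian (pos (D.next p)) = mer p :=
  congrArg PresentedGroup.of (arcAt_pos_next p)

/-- The element by which the labels of the two faces at a half-edge differ: the meridian of the
edge, inverted at the half-edges that point towards the crossing. -/
def jump (d : D.Half) : D.group :=
  if d.1.2 then mer ⟨d.1.1, d.2⟩ else (D.meridian (pos ⟨d.1.1, d.2⟩))⁻¹

theorem jump_outHalf (p : D.Edge) : jump (outHalf p) = mer p := rfl

theorem jump_inHalf (p : D.Edge) : jump (inHalf p) = (D.meridian (pos p))⁻¹ := rfl

/-- The Wirtinger relation, read around the crossing from any half-edge. -/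
theorem jump_around (d : D.Half) :
    jump d * jump (rot d) * jump (rot (rot d)) * jump (rot (rot (rot d))) = 1 := by
  -- it suffices to start at a half-edge of the under-strand
  have key : ∀ p : D.Edge, p.1.isOver = false →
      (jump (outHalf p) * jump (rot (outHalf p)) * jump (inHalf p) * jump (rot (inHalf p)) = 1 ∧
      jump (inHalf p) * jump (rot (inHalf p)) * jump (outHalf p) * jump (rot (outHalf p)) = 1) := by
    intro p hp
    have ho : (D.partner p).1.isOver = true := by simp [partner, Passage.partner, hp]
    have hm := mer_under hp
    rcases hs : p.1.positive with _ | _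
    · have h1 : rot (outHalf p) = outHalf (D.partner p) := by
        apply Subtype.ext
        simp [rot, outHalf, rotate, hp, hs, partner]
      have h2 : rot (inHalf p) = inHalf (D.partner p) := by
        apply Subtype.ext
        simp [rot, inHalf, rotate, hp, hs, partner]
      rw [hs] at hm
      simp only [h1, h2, jump_outHalf, jump_inHalf, mer_over ho, hm]
      constructor <;> simp [mul_assoc]
    · have h1 : rot (outHalf p) = inHalf (D.partner p) := by
        apply Subtype.ext
        simp [rot, outHalf, inHalf, rotate, hp, hs, partner]
      have h2 : rot (inHalf p) = outHalf (D.partner p) := by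
        apply Subtype.ext
        simp [rot, inHalf, outHalf, rotate, hp, hs, partner]
      rw [hs] at hm
      simp only [h1, h2, jump_outHalf, jump_inHalf, mer_over ho, hm]
      constructor <;> simp [mul_assoc]
  have key' : ∀ d : D.Half, d.1.1.isOver = false →
      jump d * jump (rot d) * jump (rot (rot d)) * jump (rot (rot (rot d))) = 1 := by
    intro d hd
    obtain ⟨p, rfl | rfl⟩ := half_cases d
    · rw [rot_rot_outHalf]
      exact (key p hd).1
    · rw [rot_rot_inHalf]
      exact (key p hd).2
  have rot4 : rot (rot (rot (rot d))) = d := by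
    obtain ⟨p, rfl | rfl⟩ := half_cases d
    · rw [rot_rot_outHalf, rot_rot_inHalf]
    · rw [rot_rot_inHalf, rot_rot_outHalf]
  rcases hd : d.1.1.isOver with _ | _
  · exact key' d hd
  · have h := key' (rot d) (by simp [rot, rotate, Passage.partner, hd])
    rw [rot4] at h
    have h' := congrArg (fun x => jump d * x * (jump d)⁻¹) h
    simpa [mul_assoc] using h'

/-- A labelling of the faces is good at a half-edge if it jumps there by the meridian. -/
def GoodAt (g : D.Face → D.group) (d : D.Half) : Prop := g (face (opp d)) = g (face d) * jump d

theorem jump_opp (d : D.Half) : jump (opp d) = (jump d)⁻¹ := by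
  obtain ⟨p, rfl | rfl⟩ := half_cases d
  · rw [opp_outHalf, jump_inHalf, meridian_pos_next, jump_outHalf]
  · obtain ⟨q, rfl⟩ := D.next.surjective p
    rw [opp_inHalf, jump_inHalf, meridian_pos_next, jump_outHalf, inv_inv]

theorem goodAt_opp (g : D.Face → D.group) (d : D.Half) : GoodAt g (opp d) ↔ GoodAt g d := by
  unfold GoodAt
  rw [opp_opp, jump_opp, eq_mul_inv_iff_mul_eq, eq_comm]

/-- A labelling that is good at all other half-edges at a crossing is good at the last one. -/
theorem goodAt_of_others {g : D.Face → D.group} {d : D.Half} (h1 : GoodAt g (rot d))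
    (h2 : GoodAt g (rot (rot d))) (h3 : GoodAt g (rot (rot (rot d)))) : GoodAt g d := by
  have rot4 : rot (rot (rot (rot d))) = d := by
    obtain ⟨p, rfl | rfl⟩ := half_cases d
    · rw [rot_rot_outHalf, rot_rot_inHalf]
    · rw [rot_rot_inHalf, rot_rot_outHalf]
  unfold GoodAt at *
  rw [face_opp] at *
  rw [rot4, h2, h1] at h3
  have h := jump_around d
  rw [h3]
  simp only [mul_assoc] at h ⊢
  have h' := congrArg (fun x => x * jump d) h
  simp only [mul_assoc, one_mul] at h'
  rw [mul_eq_one_iff_eq_inv] at h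
  rw [h]
  simp [mul_assoc]

theorem goodAt_of_partner {g : D.Face → D.group} {p : D.Edge}
    (h1 : GoodAt g (outHalf (D.partner p))) (h2 : GoodAt g (inHalf (D.partner p))) :
    GoodAt g (outHalf p) ↔ GoodAt g (inHalf p) := by
  have r1 := rot_rot_outHalf p
  have r2 := rot_rot_inHalf p
  rcases rot_cases p with ⟨h, h'⟩ | ⟨h, h'⟩ <;> rw [h] at r1 <;> rw [h'] at r2
  · constructor <;> intro h3 <;> apply goodAt_of_others <;>
      simpa only [h, h', r1, r2]
  · constructor <;> intro h3 <;> apply goodAt_of_others <;>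
      simpa only [h, h', r1, r2]

/-- The faces of a diagram on the sphere can be labelled by elements of the knot group so that the
labels on the two sides of an edge differ by its meridian. -/
theorem exists_faceLabel (hne : D.code ≠ []) :
    ∃ g : D.Face → D.group, ∀ d : D.Half, GoodAt g d := by
  classical
  obtain ⟨g, hg⟩ := exists_face_labelling (P := D.Edge) (V := D.Crossing) (F := D.Face)
    (fun e => D.crossingOf e) (fun e => D.crossingOf (D.next e))
    (fun e => face (outHalf e)) (fun e => face (opp (outHalf e))) (euler hne)
    crossing_connected face_connected face_orthogonal mer (by
      intro g B hB v hcard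
      have hout : ∀ p, p ∈ B ↔ ¬ GoodAt g (outHalf p) := hB
      have hin : ∀ p, p ∈ B ↔ ¬ GoodAt g (inHalf (D.next p)) := fun p => by
        rw [← opp_outHalf, goodAt_opp, hout]
      let p : D.Edge := ⟨v.1, (List.mem_filter.1 v.2).1⟩
      have hv : v = D.crossingOf p := (crossingOf_under v).symm
      have hpq : p ≠ D.partner p := fun h => p.1.partner_ne (congrArg Subtype.val h).symm
      have hcross : ∀ e, D.crossingOf e = v ↔ e ∈ ({p, D.partner p} : Finset D.Edge) := by
        intro e
        rw [hv, crossingOf_eq_iff]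
        simp
      have c1 : (B.filter fun e => D.crossingOf e = v).card =
          (if GoodAt g (outHalf p) then 0 else 1) +
            (if GoodAt g (outHalf (D.partner p)) then 0 else 1) := by
        have : (B.filter fun e => D.crossingOf e = v) =
            ({p, D.partner p} : Finset D.Edge).filter fun e => ¬ GoodAt g (outHalf e) := by
          ext e
          rw [Finset.mem_filter, Finset.mem_filter, hcross, hout, and_comm]
        rw [this, Finset.card_filter, Finset.sum_pair hpq]
        simp only [ite_not]
      have c2 : (B.filter fun e => D.crossingOf (D.next e) = v).card =
          (if GoodAt g (inHalf p) then 0 else 1) +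
            (if GoodAt g (inHalf (D.partner p)) then 0 else 1) := by
        have : (B.filter fun e => D.crossingOf (D.next e) = v).map D.next.toEmbedding =
            ({p, D.partner p} : Finset D.Edge).filter fun e => ¬ GoodAt g (inHalf e) := by
          ext e
          obtain ⟨e, rfl⟩ := D.next.surjective e
          rw [Finset.mem_map_equiv, Equiv.symm_apply_apply, Finset.mem_filter, Finset.mem_filter,
            hcross, hin, and_comm]
        rw [← Finset.card_map, this, Finset.card_filter, Finset.sum_pair hpq]
        simp only [ite_not]
      rw [c1, c2] at hcard
      have g1 := goodAt_of_partner (g := g) (p := p)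
      have g2 := goodAt_of_partner (g := g) (p := D.partner p)
      rw [partner_partner] at g2
      by_cases a1 : GoodAt g (outHalf p) <;> by_cases a2 : GoodAt g (inHalf p) <;>
        by_cases a3 : GoodAt g (outHalf (D.partner p)) <;>
        by_cases a4 : GoodAt g (inHalf (D.partner p)) <;> simp_all)
  refine ⟨g, fun d => ?_⟩
  obtain ⟨p, rfl | rfl⟩ := half_cases d
  · exact hg p
  · obtain ⟨q, rfl⟩ := D.next.surjective p
    rw [← opp_outHalf, goodAt_opp]
    exact hg q

end KnotDiagram

/-! ### Crossed homomorphisms -/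

/-- A crossed homomorphism (derivation) from a group to a module on which it acts through `Ψ`. -/
def IsCrossed {G S N : Type*} [Group G] [Ring S] [AddCommGroup N] [Module S N] (Ψ : G →* S)
    (δ : G → N) : Prop :=
  ∀ a b, δ (a * b) = δ a + Ψ a • δ b

namespace IsCrossed

variable {G S N : Type*} [Group G] [Ring S] [AddCommGroup N] [Module S N] {Ψ : G →* S} {δ : G → N}

theorem map_one (h : IsCrossed Ψ δ) : δ 1 = 0 := by
  have := h 1 1
  rwa [mul_one, Ψ.map_one, one_smul, left_eq_add] at this

theorem map_inv (h : IsCrossed Ψ δ) (a : G) : δ a⁻¹ = -(Ψ a⁻¹ • δ a) := by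
  have := h a⁻¹ a
  rw [inv_mul_cancel, h.map_one] at this
  exact eq_neg_of_add_eq_zero_left this.symm

end IsCrossed

theorem crossed_ext {X S N : Type*} [Ring S] [AddCommGroup N] [Module S N]
    {Ψ : FreeGroup X →* S} {δ δ' : FreeGroup X → N} (h : IsCrossed Ψ δ) (h' : IsCrossed Ψ δ')
    (hof : ∀ x, δ (FreeGroup.of x) = δ' (FreeGroup.of x)) (w : FreeGroup X) : δ w = δ' w := by
  induction w using FreeGroup.induction_on with
  | C1 => rw [h.map_one, h'.map_one]
  | of x => exact hof x
  | inv_of x hx => rw [h.map_inv, h'.map_inv, hx]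
  | mul a b ha hb => rw [h, h', ha, hb]

/-- A crossed homomorphism on a free group that vanishes on relators descends to the presented
group. -/
theorem exists_crossed_descend {X S N : Type*} [Ring S] [AddCommGroup N] [Module S N]
    {rels : Set (FreeGroup X)} {Ψ : PresentedGroup rels →* S} {δ : FreeGroup X → N}
    (h : IsCrossed (Ψ.comp (PresentedGroup.mk rels)) δ) (hrel : ∀ r ∈ rels, δ r = 0) :
    ∃ d : PresentedGroup rels → N, IsCrossed Ψ d ∧ ∀ w, d (PresentedGroup.mk rels w) = δ w := by
  let K : Subgroup (FreeGroup X) :=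
    { carrier := {w | PresentedGroup.mk rels w = 1 ∧ δ w = 0}
      mul_mem' := fun {a b} ha hb => ⟨by rw [map_mul, ha.1, hb.1, one_mul], by
        rw [h, ha.2, hb.2, smul_zero, add_zero]⟩
      one_mem' := ⟨map_one _, h.map_one⟩
      inv_mem' := fun {a} ha => ⟨by rw [map_inv, ha.1, inv_one], by
        rw [h.map_inv, ha.2, smul_zero, neg_zero]⟩ }
  have hK : K.Normal := ⟨fun w hw g => ⟨by
      rw [map_mul, map_mul, hw.1, mul_one, map_inv, mul_inv_cancel], by
      have h1 : (Ψ.comp (PresentedGroup.mk rels)) (g * w) =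
          (Ψ.comp (PresentedGroup.mk rels)) g := by
        rw [MonoidHom.comp_apply, map_mul, hw.1, mul_one, MonoidHom.comp_apply]
      rw [h, h g w, hw.2, smul_zero, add_zero, h1, ← h, mul_inv_cancel, h.map_one]⟩⟩
  have hle : Subgroup.normalClosure rels ≤ K := Subgroup.normalClosure_le_normal fun r hr =>
    ⟨PresentedGroup.one_of_mem hr, hrel r hr⟩
  have hwd : ∀ a b, PresentedGroup.mk rels a = PresentedGroup.mk rels b → δ a = δ b := by
    intro a b hab
    have h1 : b⁻¹ * a ∈ K := hle (PresentedGroup.mk_eq_one_iff.1 (by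
      rw [map_mul, map_inv, hab, inv_mul_cancel]))
    have h2 := h b (b⁻¹ * a)
    rwa [mul_inv_cancel_left, h1.2, smul_zero, add_zero] at h2
  choose s hs using PresentedGroup.mk_surjective rels
  have hd : ∀ w, δ (s (PresentedGroup.mk rels w)) = δ w := fun w => hwd _ _ (hs _)
  refine ⟨fun g => δ (s g), fun a b => ?_, hd⟩
  have h1 : δ (s (a * b)) = δ (s a * s b) := hwd _ _ (by rw [map_mul, hs, hs, hs])
  change δ (s (a * b)) = _
  rw [h1, h, MonoidHom.comp_apply, hs]

theorem isCrossed_sum_foxDeriv {X S N : Type} [Fintype X] [DecidableEq X] [Ring S]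
    [AddCommGroup N] [Module S N] {Ψ : FreeGroup X →* S}
    (Φ : MonoidAlgebra ℤ (FreeGroup X) →+* S) (hΦ : ∀ w, Φ (MonoidAlgebra.of ℤ _ w) = Ψ w)
    (v : X → N) : IsCrossed Ψ fun w => ∑ x, Φ (foxDeriv x w) • v x := by
  intro a b
  simp only [foxDeriv_mul, map_add, map_mul, hΦ, add_smul, mul_smul, Finset.sum_add_distrib,
    Finset.smul_sum]

/-- The fundamental formula of Fox calculus: a crossed homomorphism is determined by its values on
the generators through the free derivatives. -/
theorem crossed_eq_sum_foxDeriv {X S N : Type} [Fintype X] [DecidableEq X] [Ring S]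
    [AddCommGroup N] [Module S N] {Ψ : FreeGroup X →* S}
    (Φ : MonoidAlgebra ℤ (FreeGroup X) →+* S) (hΦ : ∀ w, Φ (MonoidAlgebra.of ℤ _ w) = Ψ w)
    {δ : FreeGroup X → N} (h : IsCrossed Ψ δ) (w : FreeGroup X) :
    δ w = ∑ x, Φ (foxDeriv x w) • δ (FreeGroup.of x) := by
  refine crossed_ext h (isCrossed_sum_foxDeriv Φ hΦ fun x => δ (FreeGroup.of x)) (fun x => ?_) w
  simp [foxDeriv_of]

/-! ### One Wirtinger relator is redundant -/

namespace KnotDiagram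

open GaussCode

variable {D : KnotDiagram}

theorem arcAt_pos_injective {p q : D.Edge} (hp : p.1.isOver = false) (hq : q.1.isOver = false)
    (h : D.arcAt (pos p) = D.arcAt (pos q)) : p = q := by
  have h1 := unders_getElem? (getElem?_pos p) hp
  have h2 := unders_getElem? (getElem?_pos q) hq
  rw [← D.arcAt_val_under (getElem?_pos p) hp, h, D.arcAt_val_under (getElem?_pos q) hq, h2] at h1
  exact Subtype.ext (Option.some.inj h1).symm

section Redundancy

variable {S N : Type*} [Ring S] [AddCommGroup N] [Module S N] (Ψ : D.group →* S)
  (δ : FreeGroup D.Arc → N) (g : D.Face → D.group)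

/-- The contribution of a passage to the sum of all relators, weighted by the face labels. -/
def weightedJump (p : D.Edge) : N :=
  Ψ (g (face (outHalf p))) • δ (FreeGroup.of (D.arcAt (pos p + 1))) -
    Ψ (g (face (opp (inHalf p)))) • δ (FreeGroup.of (D.arcAt (pos p)))

theorem sum_weightedJump : ∑ p, weightedJump Ψ δ g p = 0 := by
  simp only [weightedJump, Finset.sum_sub_distrib]
  rw [← Equiv.sum_comp D.next fun p =>
      Ψ (g (face (opp (inHalf p)))) • δ (FreeGroup.of (D.arcAt (pos p))), sub_eq_zero]
  refine Finset.sum_congr rfl fun p _ => ?_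
  rw [opp_inHalf, arcAt_pos_next]

variable {Ψ δ g}

/-- The two passages through a crossing contribute a unit multiple of its relator. -/
theorem smul_relator (hδ : IsCrossed (Ψ.comp (PresentedGroup.mk (Set.range D.relator))) δ)
    (hg : ∀ d : D.Half, GoodAt g d) {p : D.Edge} (hp : p.1.isOver = false) :
    Ψ (g (face (outHalf p))) • δ (D.relator (D.arcAt (pos p))) =
      weightedJump Ψ δ g p + weightedJump Ψ δ g (D.partner p) := by
  have ho : (D.partner p).1.isOver = true := by simp [partner, Passage.partner, hp]
  have hrot : ∀ d : D.Half, g (face (rot d)) = g (face d) * jump d := fun d => by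
    rw [← face_opp]
    exact hg d
  have hu : D.arcAt (pos (D.partner p) + 1) = D.arcAt (pos (D.partner p)) :=
    D.arcAt_succ_over (getElem?_pos _) ho
  have hm := mer_under hp
  have hrel := D.relator_arcAt (getElem?_pos p) hp
  have hpos : D.code.idxOf p.1.partner = pos (D.partner p) := rfl
  rw [hpos] at hrel
  have hmk : ∀ k, PresentedGroup.mk (Set.range D.relator) (FreeGroup.of (D.arcAt k)) =
      D.meridian k := fun _ => rfl
  have hmer : D.meridian (pos p + 1) = mer p := rfl
  have e3 : g (face (opp (inHalf p))) = g (face (inHalf p)) * (D.meridian (pos p))⁻¹ := hg _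
  have e4 : g (face (opp (inHalf (D.partner p)))) =
      g (face (inHalf (D.partner p))) * (mer (D.partner p))⁻¹ := by
    rw [← mer_over ho]
    exact hg _
  unfold weightedJump
  rw [hu, hrel]
  rcases hs : p.1.positive with _ | _
  · have h1 : rot (outHalf p) = outHalf (D.partner p) := by
      apply Subtype.ext
      simp [rot, outHalf, rotate, hp, hs, partner]
    have h2 : rot (inHalf p) = inHalf (D.partner p) := by
      apply Subtype.ext
      simp [rot, inHalf, rotate, hp, hs, partner]
    have e1 := hrot (outHalf p)
    have e2 := hrot (rot (outHalf p))
    have e5 := hrot (inHalf p)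
    rw [rot_rot_outHalf, h1, jump_outHalf] at e2
    rw [h1, jump_outHalf] at e1
    rw [h2, jump_inHalf] at e5
    rw [hs] at hm
    simp only [Bool.false_eq_true, if_false, hδ _ _, hδ.map_inv, map_mul, map_inv,
      MonoidHom.comp_apply, hmk, hmer, e3, e4, e5, e2, e1, smul_add, smul_neg, smul_smul,
      ← mer_over ho] at hm ⊢
    simp only [← map_mul, hm, mul_assoc, mul_inv_cancel, inv_mul_cancel, mul_one]
    abel
  · have h1 : rot (inHalf p) = outHalf (D.partner p) := by
      apply Subtype.ext
      simp [rot, inHalf, outHalf, rotate, hp, hs, partner]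
    have h2 : rot (outHalf p) = inHalf (D.partner p) := by
      apply Subtype.ext
      simp [rot, inHalf, outHalf, rotate, hp, hs, partner]
    have e1 := hrot (outHalf p)
    have e2 := hrot (inHalf (D.partner p))
    have e5 := hrot (inHalf p)
    rw [← h2, rot_rot_outHalf, h2, jump_inHalf] at e2
    rw [h2, jump_outHalf] at e1
    rw [h1, jump_inHalf] at e5
    rw [hs] at hm
    simp only [if_true, hδ _ _, hδ.map_inv, map_mul, map_inv,
      MonoidHom.comp_apply, hmk, hmer, e3, e4, e5, e2, e1, smul_add, smul_neg, smul_smul,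
      ← mer_over ho] at hm ⊢
    simp only [← map_mul, hm, mul_assoc, mul_inv_cancel, mul_one]
    abel

end Redundancy

/-- Every Wirtinger relator is a consequence of the others, in the form needed for Fox calculus:
the relators, weighted by the labels of adjacent faces, add up to zero. -/
theorem crossed_relator_eq_zero {S N : Type*} [Ring S] [AddCommGroup N] [Module S N]
    {Ψ : D.group →* S} {δ : FreeGroup D.Arc → N}
    (hδ : IsCrossed (Ψ.comp (PresentedGroup.mk (Set.range D.relator))) δ) (i : D.Arc)
    (h : ∀ a, a ≠ i → δ (D.relator a) = 0) : δ (D.relator i) = 0 := by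
  by_cases hne : D.code = []
  · have : D.relator i = 1 := by
      unfold relator
      simp [hne, unders]
    rw [this, hδ.map_one]
  obtain ⟨g, hg⟩ := exists_faceLabel hne
  obtain ⟨k, p, hk, hp, hi⟩ := D.exists_gap_of_arc i hne
  let p₀ : D.Edge := ⟨p, List.mem_of_getElem? hk⟩
  have hp₀ : D.arcAt (pos p₀) = i := by
    rw [← hi, ← D.idxOf_eq hk]
    rfl
  have hsum : ∑ q : D.Edge, (if q.1.isOver = false then
      Ψ (g (face (outHalf q))) • δ (D.relator (D.arcAt (pos q))) else 0) = 0 := by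
    have h1 : ∀ q : D.Edge, (if q.1.isOver = false then
        Ψ (g (face (outHalf q))) • δ (D.relator (D.arcAt (pos q))) else 0) =
        (if q.1.isOver = false then weightedJump Ψ δ g q else 0) +
          (if q.1.isOver = false then weightedJump Ψ δ g (D.partner q) else 0) := by
      intro q
      split_ifs with hq
      · exact smul_relator hδ hg hq
      · rw [add_zero]
    let τ : Equiv.Perm D.Edge := ⟨D.partner, D.partner, partner_partner, partner_partner⟩
    rw [Finset.sum_congr rfl fun q _ => h1 q, Finset.sum_add_distrib,
      ← Equiv.sum_comp τ fun q => if q.1.isOver = false then weightedJump Ψ δ g (D.partner q)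
        else 0, ← Finset.sum_add_distrib]
    refine Eq.trans ?_ (sum_weightedJump Ψ δ g)
    refine Finset.sum_congr rfl fun q _ => ?_
    change _ + (if (D.partner q).1.isOver = false then
      weightedJump Ψ δ g (D.partner (D.partner q)) else 0) = _
    rw [partner_partner]
    rcases hq : q.1.isOver with _ | _ <;> simp [partner, Passage.partner, hq]
  rw [Finset.sum_eq_single p₀, if_pos hp, hp₀] at hsum
  · have h1 := congrArg (fun n => Ψ (g (face (outHalf p₀)))⁻¹ • n) hsum
    simpa only [smul_smul, ← map_mul, inv_mul_cancel, map_one, one_smul, smul_zero] using h1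
  · intro q _ hq
    split_ifs with hqu
    · rw [h, smul_zero]
      rintro hqi
      exact hq (arcAt_pos_injective hqu hp (hqi.trans hp₀.symm))
    · rfl
  · simp

end KnotDiagram

/-! ### Conjugate representations and direct sums -/

/-- Conjugation of all blocks of a block matrix by the same matrix does not change the
determinant. -/
theorem det_of_block_conj {κ ι R : Type*} [Fintype κ] [DecidableEq κ] [Fintype ι] [DecidableEq ι]
    [CommRing R] {P Q : Matrix ι ι R} (hPQ : P * Q = 1) (X : κ → κ → Matrix ι ι R) :
    (Matrix.of fun a b : κ × ι => (P * X a.1 b.1 * Q) a.2 b.2).det =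
      (Matrix.of fun a b : κ × ι => X a.1 b.1 a.2 b.2).det := by
  let f := Matrix.compRingEquiv κ ι R
  have h : (Matrix.of fun a b : κ × ι => (P * X a.1 b.1 * Q) a.2 b.2) =
      f (Matrix.diagonal fun _ => P) * f (Matrix.of X) * f (Matrix.diagonal fun _ => Q) := by
    rw [← map_mul, ← map_mul]
    ext a b
    change _ = (Matrix.diagonal (fun _ => P) * Matrix.of X * Matrix.diagonal fun _ => Q :
      Matrix κ κ (Matrix ι ι R))
      a.1 b.1 a.2 b.2
    rw [Matrix.mul_diagonal, Matrix.diagonal_mul]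
    rfl
  have h1 : (f (Matrix.diagonal fun _ => P)).det * (f (Matrix.diagonal fun _ => Q)).det = 1 := by
    rw [← Matrix.det_mul, ← map_mul, Matrix.diagonal_mul_diagonal, hPQ]
    have : (Matrix.diagonal fun _ : κ => (1 : Matrix ι ι R)) = 1 := Matrix.diagonal_one
    rw [this, map_one, Matrix.det_one]
  rw [h, Matrix.det_mul, Matrix.det_mul, mul_right_comm, h1, one_mul]
  rfl

namespace KnotDiagram

variable (D : KnotDiagram) {m : ℕ} (ρ : D.group →* Matrix.GeneralLinearGroup (Fin m) ℂ)

theorem Phi_of (w : FreeGroup D.Arc) :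
    D.Phi ρ (MonoidAlgebra.of ℤ _ w) = D.tensorAbel ρ (PresentedGroup.mk _ w) := by
  simp [Phi]

theorem Phi_of_of (j : D.Arc) :
    D.Phi ρ (MonoidAlgebra.of ℤ _ (FreeGroup.of j)) = D.tensorAbel ρ (PresentedGroup.of j) :=
  D.Phi_of ρ _

theorem tensorAbel_apply (g : D.group) :
    D.tensorAbel ρ g = (LaurentPolynomial.T (Multiplicative.toAdd (D.abel g)) : ℂ[T;T⁻¹]) •
      (ρ g : Matrix (Fin m) (Fin m) ℂ).map (LaurentPolynomial.C : ℂ →+* ℂ[T;T⁻¹]) := rfl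

variable {D ρ}

theorem twistedAlexander_eq_of_repEquiv {ρ' : D.group →* Matrix.GeneralLinearGroup (Fin m) ℂ}
    (h : RepEquiv ρ ρ') (i j : D.Arc) : D.twistedAlexander ρ i j = D.twistedAlexander ρ' i j := by
  obtain ⟨P, hP⟩ := h
  let Q : Matrix (Fin m) (Fin m) ℂ[T;T⁻¹] :=
    P.1.map (LaurentPolynomial.C : ℂ →+* ℂ[T;T⁻¹])
  let Q' : Matrix (Fin m) (Fin m) ℂ[T;T⁻¹] :=
    (P⁻¹).1.map (LaurentPolynomial.C : ℂ →+* ℂ[T;T⁻¹])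
  have hQ : Q' * Q = 1 := by
    rw [← Matrix.map_mul, ← Units.val_mul, inv_mul_cancel, Units.val_one]
    simp
  have h1 : ∀ g, D.tensorAbel ρ' g = Q' * D.tensorAbel ρ g * Q := by
    intro g
    rw [tensorAbel_apply, tensorAbel_apply, hP, Units.val_mul, Units.val_mul, Matrix.map_mul,
      Matrix.map_mul, mul_smul_comm, smul_mul_assoc]
  have h2 : ∀ x, D.Phi ρ' x = Q' * D.Phi ρ x * Q := by
    intro x
    induction x using MonoidAlgebra.induction_on with
    | of w => rw [Phi_of, Phi_of, h1]
    | add x y hx hy => rw [map_add, map_add, hx, hy, mul_add, add_mul]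
    | smul r x hx => rw [map_zsmul, map_zsmul, hx, mul_smul_comm, smul_mul_assoc]
  have hnum : (D.alexanderMatrix ρ' i j).det = (D.alexanderMatrix ρ i j).det := by
    rw [alexanderMatrix, alexanderMatrix]
    simp only [h2]
    exact det_of_block_conj hQ fun a b =>
      D.Phi ρ (foxDeriv (j.succAbove b) (D.relator (i.succAbove a)))
  have hden : ∀ x, (1 - Q' * x * Q).det = (1 - x).det := by
    intro x
    have : 1 - Q' * x * Q = Q' * (1 - x) * Q := by
      rw [mul_sub, sub_mul, mul_one, hQ]
    rw [this, Matrix.det_mul, Matrix.det_mul, mul_right_comm, ← Matrix.det_mul, hQ,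
      Matrix.det_one, one_mul]
  rw [twistedAlexander, twistedAlexander, hnum, h2, hden]

section Sum

variable {m₁ m₂ : ℕ} (ρ₁ : D.group →* Matrix.GeneralLinearGroup (Fin m₁) ℂ)
  (ρ₂ : D.group →* Matrix.GeneralLinearGroup (Fin m₂) ℂ)

theorem Phi_repSum (x : MonoidAlgebra ℤ (FreeGroup D.Arc)) :
    D.Phi (RepSum ρ₁ ρ₂) x = Matrix.reindex finSumFinEquiv finSumFinEquiv
      (Matrix.fromBlocks (D.Phi ρ₁ x) 0 0 (D.Phi ρ₂ x)) := by
  induction x using MonoidAlgebra.induction_on with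
  | of w =>
    rw [Phi_of, Phi_of, Phi_of, tensorAbel_apply, tensorAbel_apply, tensorAbel_apply]
    change _ • (Matrix.reindex finSumFinEquiv finSumFinEquiv
      (Matrix.fromBlocks (ρ₁ _ : Matrix (Fin m₁) (Fin m₁) ℂ) 0 0
        (ρ₂ _ : Matrix (Fin m₂) (Fin m₂) ℂ))).map _ = _
    ext k l : 1
    obtain ⟨k, rfl⟩ := finSumFinEquiv.surjective k
    obtain ⟨l, rfl⟩ := finSumFinEquiv.surjective l
    rcases k with k | k <;> rcases l with l | l <;> simp
  | add x y hx hy =>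
    rw [map_add, map_add, map_add, hx, hy]
    ext k l : 1
    obtain ⟨k, rfl⟩ := finSumFinEquiv.surjective k
    obtain ⟨l, rfl⟩ := finSumFinEquiv.surjective l
    rcases k with k | k <;> rcases l with l | l <;> simp
  | smul r x hx =>
    rw [map_zsmul, map_zsmul, map_zsmul, hx]
    ext k l : 1
    obtain ⟨k, rfl⟩ := finSumFinEquiv.surjective k
    obtain ⟨l, rfl⟩ := finSumFinEquiv.surjective l
    rcases k with k | k <;> rcases l with l | l <;> simp [-zsmul_eq_mul, Matrix.smul_apply]

theorem twistedAlexander_repSum (i j : D.Arc) :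
    D.twistedAlexander (RepSum ρ₁ ρ₂) i j =
      D.twistedAlexander ρ₁ i j * D.twistedAlexander ρ₂ i j := by
  have hden : ∀ x, (1 - D.Phi (RepSum ρ₁ ρ₂) x).det =
      (1 - D.Phi ρ₁ x).det * (1 - D.Phi ρ₂ x).det := by
    intro x
    have h1 : 1 - D.Phi (RepSum ρ₁ ρ₂) x = Matrix.reindex finSumFinEquiv finSumFinEquiv
        (Matrix.fromBlocks (1 - D.Phi ρ₁ x) 0 0 (1 - D.Phi ρ₂ x)) := by
      rw [Phi_repSum]
      ext k l : 1
      obtain ⟨k, rfl⟩ := finSumFinEquiv.surjective k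
      obtain ⟨l, rfl⟩ := finSumFinEquiv.surjective l
      rcases k with k | k <;> rcases l with l | l <;>
        simp [-finSumFinEquiv_apply_left, -finSumFinEquiv_apply_right, Matrix.one_apply]
    rw [h1, Matrix.det_reindex_self, Matrix.det_fromBlocks_zero₂₁]
  have hnum : (D.alexanderMatrix (RepSum ρ₁ ρ₂) i j).det =
      (D.alexanderMatrix ρ₁ i j).det * (D.alexanderMatrix ρ₂ i j).det := by
    rw [← Matrix.det_fromBlocks_zero₂₁ _ 0, ← Matrix.det_reindex_self
      ((Equiv.prodCongr (Equiv.refl _) finSumFinEquiv.symm).trans (Equiv.prodSumDistrib _ _ _))]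
    congr 1
    ext (⟨a, k⟩ | ⟨a, k⟩) (⟨b, l⟩ | ⟨b, l⟩) <;>
      simp [alexanderMatrix, Phi_repSum]
  rw [twistedAlexander, twistedAlexander, twistedAlexander, hnum, hden, map_mul, map_mul,
    div_mul_div_comm]

end Sum

end KnotDiagram

/-! ### The Alexander module -/

open scoped Matrix.Module

namespace KnotDiagram

variable (D : KnotDiagram) {m : ℕ} (ρ : D.group →* Matrix.GeneralLinearGroup (Fin m) ℂ)
  (i j : D.Arc)

/-- The module presented by the matrix whose determinant is the numerator of the twisted Alexander
polynomial. -/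
abbrev AlexanderModule : Type :=
  (Fin ((GaussCode.unders D.code).length - 1) × Fin m → ℂ[T;T⁻¹]) ⧸
    Submodule.span ℂ[T;T⁻¹] (Set.range (D.alexanderMatrix ρ i j).row)

/-- The Alexander module carries the universal crossed homomorphism of the knot group that
vanishes on the meridian `x_j`. This uses that the omitted relator is redundant. -/
theorem exists_universal_crossed :
    ∃ δ : D.group → (Fin m → D.AlexanderModule ρ i j),
      IsCrossed (D.tensorAbel ρ) δ ∧ δ (PresentedGroup.of j) = 0 ∧
      (∀ (Y : Type) [AddCommGroup Y] [Module ℂ[T;T⁻¹] Y] (d : D.group → (Fin m → Y)),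
        IsCrossed (D.tensorAbel ρ) d → d (PresentedGroup.of j) = 0 →
        ∃ L : D.AlexanderModule ρ i j →ₗ[ℂ[T;T⁻¹]] Y, ∀ g l, L (δ g l) = d g l) ∧
      ∀ f : D.AlexanderModule ρ i j →ₗ[ℂ[T;T⁻¹]] D.AlexanderModule ρ i j,
        (∀ g l, f (δ g l) = δ g l) → f = LinearMap.id := by
  let mk := (Submodule.span ℂ[T;T⁻¹] (Set.range (D.alexanderMatrix ρ i j).row)).mkQ
  let v : D.Arc → (Fin m → D.AlexanderModule ρ i j) :=
    j.insertNth (α := fun _ => Fin m → D.AlexanderModule ρ i j) 0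
      fun b l => mk (Pi.single (b, l) 1)
  have hvj : v j = 0 := Fin.insertNth_apply_same ..
  have hvs : ∀ b, v (j.succAbove b) = fun l => mk (Pi.single (b, l) 1) :=
    fun b => Fin.insertNth_apply_succAbove ..
  let Ψ := (D.tensorAbel ρ).comp (PresentedGroup.mk (Set.range D.relator))
  have hΦ : ∀ w, D.Phi ρ (MonoidAlgebra.of ℤ _ w) = Ψ w := D.Phi_of ρ
  let δ₀ : FreeGroup D.Arc → (Fin m → D.AlexanderModule ρ i j) :=
    fun w => ∑ x, D.Phi ρ (foxDeriv x w) • v x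
  have hδ₀ : IsCrossed Ψ δ₀ := isCrossed_sum_foxDeriv (D.Phi ρ) hΦ v
  have hof : ∀ x, δ₀ (FreeGroup.of x) = v x := fun x => by simp [δ₀, foxDeriv_of]
  have hrow : ∀ a, δ₀ (D.relator (i.succAbove a)) = 0 := by
    intro a
    funext k
    have h1 : δ₀ (D.relator (i.succAbove a)) k = mk ((D.alexanderMatrix ρ i j).row (a, k)) := by
      rw [pi_eq_sum_univ' ((D.alexanderMatrix ρ i j).row (a, k)), map_sum, Fintype.sum_prod_type]
      simp only [δ₀, Fin.sum_univ_succAbove _ j, hvj, hvs, smul_zero, zero_add, Finset.sum_apply,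
        Matrix.Module.smul_apply, map_smul]
      rfl
    rw [h1]
    exact (Submodule.Quotient.mk_eq_zero _).2 (Submodule.subset_span ⟨(a, k), rfl⟩)
  have hrel : ∀ r ∈ Set.range D.relator, δ₀ r = 0 := by
    rintro _ ⟨a, rfl⟩
    have hne : ∀ a, a ≠ i → δ₀ (D.relator a) = 0 := by
      intro a ha
      obtain ⟨b, rfl⟩ := Fin.exists_succAbove_eq ha
      exact hrow b
    by_cases ha : a = i
    · rw [ha]
      exact crossed_relator_eq_zero hδ₀ i hne
    · exact hne a ha
  obtain ⟨δ, hδ, hδmk⟩ := exists_crossed_descend hδ₀ hrel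
  have hδof : ∀ x, δ (PresentedGroup.of x) = v x := fun x => (hδmk _).trans (hof x)
  refine ⟨δ, hδ, (hδof j).trans hvj, fun Y _ _ d hd hdj => ?_, fun f hf => ?_⟩
  · let c := Fintype.linearCombination ℂ[T;T⁻¹]
      fun x : Fin ((GaussCode.unders D.code).length - 1) × Fin m =>
        d (PresentedGroup.of (j.succAbove x.1)) x.2
    have hd' : IsCrossed Ψ fun w => d (PresentedGroup.mk _ w) := fun a b => by
      simp only [map_mul]
      exact hd _ _
    have hc : Submodule.span ℂ[T;T⁻¹] (Set.range (D.alexanderMatrix ρ i j).row) ≤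
        LinearMap.ker c := by
      rw [Submodule.span_le]
      rintro _ ⟨⟨a, k⟩, rfl⟩
      have h1 := crossed_eq_sum_foxDeriv (D.Phi ρ) hΦ hd' (D.relator (i.succAbove a))
      simp only [D.mk_relator, hd.map_one] at h1
      have h2 := congrFun h1 k
      simp only [Fin.sum_univ_succAbove _ j, D.mk_of, hdj, Finset.sum_apply,
        Matrix.Module.smul_apply, Pi.zero_apply, smul_zero, Finset.sum_const_zero, zero_add] at h2
      rw [SetLike.mem_coe, LinearMap.mem_ker, Fintype.linearCombination_apply,
        Fintype.sum_prod_type]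
      exact h2.symm
    let L := Submodule.liftQ _ c hc
    have hLof : ∀ x l, L (v x l) = d (PresentedGroup.of x) l := by
      intro x l
      by_cases hx : x = j
      · rw [hx, hvj, hdj]
        exact map_zero L
      · obtain ⟨b, rfl⟩ := Fin.exists_succAbove_eq hx
        rw [hvs]
        change c (Pi.single (b, l) 1) = _
        rw [Fintype.linearCombination_apply_single, one_smul]
    have hL : IsCrossed Ψ fun w => fun l => L (δ (PresentedGroup.mk _ w) l) := by
      intro a b
      funext l
      simp only [map_mul, hδ _ _, Pi.add_apply, map_add, Matrix.Module.smul_apply, map_sum,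
        map_smul]
      rfl
    refine ⟨L, fun g l => ?_⟩
    obtain ⟨w, rfl⟩ := PresentedGroup.mk_surjective _ g
    refine congrFun (crossed_ext hL hd' (fun x => ?_) w) l
    funext l
    rw [hδmk, hof]
    exact hLof x l
  · apply Submodule.linearMap_qext
    apply LinearMap.pi_ext'
    rintro ⟨b, l⟩
    ext
    have h1 := hf (PresentedGroup.of (j.succAbove b)) l
    rw [hδof, hvs] at h1
    exact h1

variable {D} {D' : KnotDiagram}

/-- The Alexander module depends only on the knot group, the representation and one meridian, so
the numerators of two diagrams with matching data are associated. -/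
theorem associated_det_alexanderMatrix (φ : D.group ≃* D'.group)
    {ρ : D.group →* Matrix.GeneralLinearGroup (Fin m) ℂ}
    {ρ' : D'.group →* Matrix.GeneralLinearGroup (Fin m) ℂ}
    (hρ : ∀ g, D.tensorAbel ρ g = D'.tensorAbel ρ' (φ g)) (i j : D.Arc) (i' j' : D'.Arc)
    (hj : φ (PresentedGroup.of j) = PresentedGroup.of j') :
    Associated (D.alexanderMatrix ρ i j).det (D'.alexanderMatrix ρ' i' j').det := by
  obtain ⟨δ, hδ, hδj, huniv, hid⟩ := D.exists_universal_crossed ρ i j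
  obtain ⟨δ', hδ', hδj', huniv', hid'⟩ := D'.exists_universal_crossed ρ' i' j'
  obtain ⟨L, hL⟩ := huniv _ (fun g => δ' (φ g))
    (fun a b => by simp only [map_mul, hδ' _ _, hρ]) (by simp only [hj, hδj'])
  obtain ⟨L', hL'⟩ := huniv' _ (fun g => δ (φ.symm g))
    (fun a b => by simp only [map_mul, hδ _ _, hρ, φ.apply_symm_apply])
    (by simp only [← hj, φ.symm_apply_apply, hδj])
  apply associated_det_of_cokernel_equiv
  refine LinearEquiv.ofLinearMap L L' (hid' _ fun g l => ?_) (hid _ fun g l => ?_)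
  · rw [LinearMap.comp_apply, hL', hL, φ.apply_symm_apply]
  · rw [LinearMap.comp_apply, hL, hL', φ.symm_apply_apply]

/-! ### Invariance -/

/-- An isomorphism of knot groups that sends meridians to conjugates of meridians. -/
def IsMeridional (φ : D.group ≃* D'.group) : Prop :=
  ∀ (j : D.Arc) (j' : D'.Arc), IsConj (φ (PresentedGroup.of j)) (PresentedGroup.of j')

variable (D) in
/-- The meridians of a knot are conjugate, as one under-passes from each arc to the next. -/
theorem isConj_meridian (j j' : D.Arc) :
    IsConj (PresentedGroup.of j : D.group) (PresentedGroup.of j') := by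
  have h0 : ∀ k ≤ D.code.length, IsConj (D.meridian 0) (D.meridian k) := by
    intro k hk
    induction k with
    | zero => exact IsConj.refl _
    | succ k ih =>
      refine (ih (Nat.le_of_succ_le hk)).trans ?_
      obtain ⟨p, hp⟩ : ∃ p, D.code[k]? = some p := ⟨_, List.getElem?_eq_getElem hk⟩
      rcases hb : p.isOver with _ | _
      · rw [D.meridian_succ_under hp hb, isConj_iff]
        split_ifs
        · exact ⟨(D.meridian (D.code.idxOf p.partner))⁻¹, by rw [inv_inv]⟩
        · exact ⟨_, rfl⟩
      · rw [D.meridian_succ_over hp hb]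
  obtain ⟨k, hk, rfl⟩ := D.exists_gap_eq_arc j
  obtain ⟨k', hk', rfl⟩ := D.exists_gap_eq_arc j'
  exact (h0 k hk).symm.trans (h0 k' hk')

theorem abel_of (j : D.Arc) : D.abel (PresentedGroup.of j) = Multiplicative.ofAdd 1 :=
  PresentedGroup.toGroup.of _

theorem IsMeridional.abel {φ : D.group ≃* D'.group} (h : IsMeridional φ) (g : D.group) :
    D'.abel (φ g) = D.abel g := by
  have : D'.abel.comp φ.toMonoidHom = D.abel := by
    apply PresentedGroup.ext
    intro j
    have h1 := D'.abel.map_isConj (h j 0)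
    rw [isConj_iff_eq, abel_of] at h1
    rw [abel_of]
    exact h1
  exact DFunLike.congr_fun this g

theorem IsMeridional.eqUpToUnit {φ : D.group ≃* D'.group} (h : IsMeridional φ)
    (ρ : D'.group →* Matrix.GeneralLinearGroup (Fin m) ℂ) (i j : D.Arc) (i' j' : D'.Arc) :
    EqUpToUnit (D.twistedAlexander (ρ.comp φ.toMonoidHom) i j) (D'.twistedAlexander ρ i' j') := by
  -- after an inner automorphism the chosen meridians correspond, and the representation is only
  -- replaced by a conjugate one
  obtain ⟨c, hc⟩ := isConj_iff.1 (h j j')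
  let φ' : D.group ≃* D'.group := φ.trans (MulAut.conj c)
  have hφ' : ∀ g, φ' g = c * φ g * c⁻¹ := fun g => rfl
  have hequiv : RepEquiv (ρ.comp φ.toMonoidHom) (ρ.comp φ'.toMonoidHom) := by
    refine ⟨ρ c⁻¹, fun g => ?_⟩
    change ρ (φ' g) = (ρ c⁻¹)⁻¹ * ρ (φ g) * ρ c⁻¹
    rw [hφ', map_mul, map_mul, map_inv, inv_inv]
  have hρ : ∀ g, D.tensorAbel (ρ.comp φ'.toMonoidHom) g = D'.tensorAbel ρ (φ' g) := by
    intro g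
    have h1 : D'.abel (φ' g) = D.abel g := by
      rw [hφ', map_mul, map_mul, map_inv, mul_inv_cancel_comm, h.abel]
    rw [tensorAbel_apply, tensorAbel_apply, h1]
    rfl
  obtain ⟨u, hu⟩ := associated_det_alexanderMatrix φ' hρ i j i' j' hc
  rw [twistedAlexander_eq_of_repEquiv hequiv]
  refine ⟨u⁻¹, ?_⟩
  have hj : φ' (PresentedGroup.of j) = PresentedGroup.of j' := hc
  rw [twistedAlexander, twistedAlexander, Phi_of_of, Phi_of_of, hρ, hj, ← hu, map_mul,
    ← mul_div_assoc, mul_left_comm, ← map_mul, Units.inv_mul, map_one, mul_one]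

theorem isMeridional_of_matchesMeridians {E : ℕ → ℕ → Prop}
    (h : ReidemeisterMove D.code D'.code E) {φ : D.group ≃* D'.group}
    (hφ : D.MatchesMeridians D' E φ) : IsMeridional φ := by
  intro j j'
  obtain ⟨k, k', hk⟩ := h.exists_gap
  have h1 := φ.toMonoidHom.map_isConj (D.isConj_meridian j (D.arcAt k))
  refine IsConj.trans h1 ?_
  have h2 : φ (PresentedGroup.of (D.arcAt k)) = PresentedGroup.of (D'.arcAt k') := hφ k k' hk
  change IsConj (φ _) _
  rw [h2]
  exact D'.isConj_meridian _ _

theorem isMeridional_of_isotopyIso {φ : D.group ≃* D'.group} (h : IsotopyIso D D' φ) :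
    IsMeridional φ := by
  induction h with
  | refl D => exact fun j j' => D.isConj_meridian j j'
  | move D D' E φ h hφ => exact isMeridional_of_matchesMeridians h hφ
  | symm D D' φ h ih =>
    intro j j'
    have h1 := φ.symm.toMonoidHom.map_isConj (ih j' j).symm
    change IsConj _ (φ.symm (φ _)) at h1
    rwa [φ.symm_apply_apply] at h1
  | trans D D' D'' φ ψ h h' ih ih' =>
    intro j j''
    exact (ψ.toMonoidHom.map_isConj (ih j 0)).trans (ih' 0 j'')

theorem exists_isotopyIso (h : D.Equivalent D') :
    ∃ φ : D.group ≃* D'.group, IsotopyIso D D' φ := by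
  induction h with
  | rel D D' h =>
    obtain ⟨E, hE⟩ := h
    obtain ⟨φ, hφ, -⟩ := existsUnique_matchesMeridians hE
    exact ⟨φ, .move D D' E φ hE hφ⟩
  | refl D => exact ⟨_, .refl D⟩
  | symm D D' _ ih =>
    obtain ⟨φ, hφ⟩ := ih
    exact ⟨_, .symm D D' φ hφ⟩
  | trans D D' D'' _ _ ih ih' =>
    obtain ⟨φ, hφ⟩ := ih
    obtain ⟨ψ, hψ⟩ := ih'
    exact ⟨_, .trans D D' D'' φ ψ hφ hψ⟩

end KnotDiagram

end

theorem mainTheorem5 :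
    -- every Reidemeister move induces a unique isomorphism of knot groups
    (∀ (D D' : KnotDiagram) (E : ℕ → ℕ → Prop), ReidemeisterMove D.code D'.code E →
      ∃! φ : D.group ≃* D'.group, D.MatchesMeridians D' E φ) ∧
    -- independence of the choices, and invariance under each Reidemeister move
    (∀ (D : KnotDiagram) (m : ℕ) (ρ : D.group →* Matrix.GeneralLinearGroup (Fin m) ℂ)
      (i j i' j' : D.Arc),
      EqUpToUnit (D.twistedAlexander ρ i j) (D.twistedAlexander ρ i' j')) ∧
    (∀ (D D' : KnotDiagram) (E : ℕ → ℕ → Prop), ReidemeisterMove D.code D'.code E →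
      ∀ φ : D.group ≃* D'.group, D.MatchesMeridians D' E φ →
      ∀ (m : ℕ) (ρ : D'.group →* Matrix.GeneralLinearGroup (Fin m) ℂ)
        (i j : D.Arc) (i' j' : D'.Arc),
        EqUpToUnit (D.twistedAlexander (ρ.comp φ.toMonoidHom) i j)
          (D'.twistedAlexander ρ i' j')) ∧
    -- hence it is an invariant of the knot
    (∀ D D' : KnotDiagram, D.Equivalent D' →
      ∃ φ : D.group ≃* D'.group, KnotDiagram.IsotopyIso D D' φ) ∧
    (∀ (D D' : KnotDiagram) (φ : D.group ≃* D'.group), KnotDiagram.IsotopyIso D D' φ →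
      ∀ (m : ℕ) (ρ : D'.group →* Matrix.GeneralLinearGroup (Fin m) ℂ)
        (i j : D.Arc) (i' j' : D'.Arc),
        EqUpToUnit (D.twistedAlexander (ρ.comp φ.toMonoidHom) i j)
          (D'.twistedAlexander ρ i' j')) ∧
    -- conjugate representations
    (∀ (D : KnotDiagram) (m : ℕ) (ρ ρ' : D.group →* Matrix.GeneralLinearGroup (Fin m) ℂ),
      RepEquiv ρ ρ' → ∀ i j : D.Arc, D.twistedAlexander ρ i j = D.twistedAlexander ρ' i j) ∧
    -- direct sums
    (∀ (D : KnotDiagram) (m₁ m₂ : ℕ)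
      (ρ₁ : D.group →* Matrix.GeneralLinearGroup (Fin m₁) ℂ)
      (ρ₂ : D.group →* Matrix.GeneralLinearGroup (Fin m₂) ℂ)
      (ρ : D.group →* Matrix.GeneralLinearGroup (Fin (m₁ + m₂)) ℂ),
      RepEquiv ρ (RepSum ρ₁ ρ₂) → ∀ i j : D.Arc,
        D.twistedAlexander ρ i j = D.twistedAlexander ρ₁ i j * D.twistedAlexander ρ₂ i j) := by
  refine ⟨fun D D' E h => KnotDiagram.existsUnique_matchesMeridians h, fun D m ρ i j i' j' => ?_,
    fun D D' E h φ hφ m ρ i j i' j' => ?_, fun D D' h => KnotDiagram.exists_isotopyIso h,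
    fun D D' φ hφ m ρ i j i' j' => ?_, fun D m ρ ρ' h i j => ?_, fun D m₁ m₂ ρ₁ ρ₂ ρ h i j => ?_⟩
  · exact (KnotDiagram.isMeridional_of_isotopyIso (.refl D)).eqUpToUnit ρ i j i' j'
  · exact (KnotDiagram.isMeridional_of_matchesMeridians h hφ).eqUpToUnit ρ i j i' j'
  · exact (KnotDiagram.isMeridional_of_isotopyIso hφ).eqUpToUnit ρ i j i' j'
  · exact KnotDiagram.twistedAlexander_eq_of_repEquiv h i j
  · rw [KnotDiagram.twistedAlexander_eq_of_repEquiv h,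
      KnotDiagram.twistedAlexander_repSum]
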